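/- Let $\mathcal A$ be a unital complex Banach algebra and let $\varphi:\mathcal A\to\mathbb C$ be a continuous linear functional with $\varphi(1)=1$. For $a\in\mathcal A$ put $G_a(z)=\varphi((z1-a)^{-1})$; let $K_a$ be the inverse of $G_a$ near $0$, i.e. the germ of a function defined for $z\neq 0$ near $0$ with $K_a(z)\to\infty$ as $z\to 0$ and $G_a(K_a(z))=z$. For $b\in\mathcal A$ with $\varphi(b)\ne 0$ put $\psi_b(s)=\varphi((1-sb)^{-1})-1$ and let $\mathcal X_b$ be the inverse of $\psi_b$ near $0$, i.e. the germ with $\mathcal X_b(w)\to 0$ as $w\to 0$ and $\psi_b(\mathcal X_b(w))=w$. Put $F_{a,b}(t,s)=\varphi((t1-a)^{-1}(1-sb)^{-1})$ and, if $\varphi(b)\ne 0$, define the partial bi-free $T$-transform, for $z,w\in\mathbb C\setminus\{0\}$ near $0$, by $$T_{a,b}(z,w)=\frac{w+1}{w}\left(1-\frac{z}{F_{a,b}(K_a(z),\mathcal X_b(w))}\right).$$ Two two-faced pairs $(a_1,b_1)$ and $(a_2,b_2)$ in $\mathcal A$ (left variables $a_k$, right variables $b_k$) are bi-free if there are complex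 vector spaces $X_k=\mathbb C\xi_k\oplus X_k^\circ$ with specified vectors $\xi_k$ and linear operators $L_k,R_k$ on $X_k$ ($k=1,2$) such that, for every polynomial $P$ in four noncommuting variables, $\varphi(P(a_1,a_2,b_1,b_2))$ equals the coefficient of $\xi$ in $P(\lambda_1(L_1),\lambda_2(L_2),\rho_1(R_1),\rho_2(R_2))\xi$. Here $X=\mathbb C\xi\oplus\bigoplus_{n\ge1}\bigoplus_{k_1\neq k_2\neq\cdots\neq k_n}X^\circ_{k_1}\otimes\cdots\otimes X^\circ_{k_n}$ is the free product of $(X_1,\xi_1)$ and $(X_2,\xi_2)$, and $\lambda_k(L)=L\otimes 1$, $\rho_k(R)=1\otimes R$ with respect to the natural identifications $X\cong X_k\otimes X(\ell,k)$ and $X\cong X(r,k)\otimes X_k$, where $X(\ell,k)$ (resp. $X(r,k)$) is the sum of $\mathbb C\xi$ and the summands of $X$ with $k_1\neq k$ (resp. $k_n\ne k$). **Theorem 3.1.** Let $(a_1,b_1)$ and $(a_2,b_2)$ be bi-free two-faced pairs in $(\mathcal A,\varphi)$ with $\varphi(b_1)\neq0$ and $\varphi(b_2)\ne0$. Then $\varphi(b_1b_2)\neq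 0$ and $$T_{a_1+a_2,\,b_1b_2}(z,w)=T_{a_1,b_1}(z,w)\,T_{a_2,b_2}(z,w)$$ for all $(z,w)\in(\mathbb C\setminus\{0\})^2$ sufficiently near $(0,0)$. -/

import Mathlib

open Filter Topology

universe u v w

noncomputable section

namespace BiFree

/-! ### Vector spaces with a specified vector and their free product -/

/-- A complex vector space with a specified vector `vec` and a specified complement `ker state` of
the line through `vec`; `state` is the functional reading off the coefficient of `vec`. -/
structure PointedSpace : Type (v + 1) where
  carrier : Type v
  [addCommGroup : AddCommGroup carrier]
  [module : Module ℂ carrier]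
  vec : carrier
  state : carrier →ₗ[ℂ] ℂ
  state_vec : state vec = 1

attribute [instance] PointedSpace.addCommGroup PointedSpace.module

/-- The specified complement of the line through the specified vector. -/
abbrev PointedSpace.compl (E : PointedSpace.{v}) : Submodule ℂ E.carrier := LinearMap.ker E.state

/-- The projection onto the complement along the specified vector. -/
def PointedSpace.proj (E : PointedSpace.{v}) : E.carrier →ₗ[ℂ] E.compl :=
  LinearMap.codRestrict E.compl (LinearMap.id - E.state.smulRight E.vec) (fun x => by
    simp [LinearMap.mem_ker, E.state_vec])

theorem PointedSpace.coe_proj (E : PointedSpace.{v}) (x : E.carrier) :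
    (E.proj x : E.carrier) = x - E.state x • E.vec := rfl

section FreeProduct

variable {κ : Type w} [DecidableEq κ] (X : κ → PointedSpace.{v})

/-- The direct sum of the complements; the free product is built inside its tensor algebra. -/
abbrev Letters : Type (max w v) := DirectSum κ (fun k => (X k).compl)

abbrev Tensors : Type (max w v) := TensorAlgebra ℂ (Letters X)

/-- A vector of the `k`-th complement as a tensor of degree one. -/
def letter (k : κ) : (X k).compl →ₗ[ℂ] Tensors X :=
  TensorAlgebra.ι ℂ ∘ₗ DirectSum.lof ℂ κ (fun k => (X k).compl) k

/-- The copy of the `k`-th space inside the tensors: the specified vector goes to the empty tensor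
`1`, the complement to the tensors of degree one. -/
def embed (k : κ) : (X k).carrier →ₗ[ℂ] Tensors X :=
  (X k).state.smulRight (1 : Tensors X) + letter X k ∘ₗ (X k).proj

/-- The elementary tensor `x₁ ⊗ ⋯ ⊗ xₙ`, where `xᵢ` lies in the complement with index `kᵢ`. -/
def tensorWord (l : List (Σ k, (X k).compl)) : Tensors X :=
  (l.map fun p => letter X p.1 p.2).prod

/-- Neighbouring indices of the word are different. -/
def Alternating (l : List (Σ k, (X k).compl)) : Prop := (l.map Sigma.fst).IsChain (· ≠ ·)

/-- The underlying space of the free product: the span `ℂ 1 ⊕ ⨁ X°_{k₁} ⊗ ⋯ ⊗ X°_{kₙ}`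
(`k₁ ≠ k₂ ≠ ⋯ ≠ kₙ`, `n ≥ 1`) of the alternating elementary tensors. -/
def freeSpace : Submodule ℂ (Tensors X) :=
  Submodule.span ℂ (tensorWord X '' {l | Alternating X l})

theorem one_mem_freeSpace : (1 : Tensors X) ∈ freeSpace X :=
  Submodule.subset_span ⟨[], by simp [Alternating], by simp [tensorWord]⟩

/-- The free product of vector spaces with specified vectors. Its specified vector is the empty
tensor and its functional reads off the degree-zero part. -/
def freeProduct : PointedSpace.{max w v} where
  carrier := freeSpace X
  vec := ⟨1, one_mem_freeSpace X⟩
  state := (TensorAlgebra.algebraMapInv (R := ℂ) (M := Letters X)).toLinearMap ∘ₗ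
    (freeSpace X).subtype
  state_vec := by simp

variable {X}

/-- For `v` of degree one, the value at `v` of the left action of `T`: the component `v_k` is
replaced by `T v_k`, the remaining part `v'` by `T ξ_k ⊗ v'`. -/
def leftLetter (k : κ) (T : Module.End ℂ (X k).carrier) : Letters X →ₗ[ℂ] Tensors X :=
  (embed X k ∘ₗ T ∘ₗ (X k).compl.subtype) ∘ₗ
      DirectSum.component ℂ κ (fun k => (X k).compl) k +
    LinearMap.mulLeft ℂ (embed X k (T (X k).vec)) ∘ₗ TensorAlgebra.ι ℂ ∘ₗ
      (LinearMap.id - DirectSum.lof ℂ κ (fun k => (X k).compl) k ∘ₗ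
        DirectSum.component ℂ κ (fun k => (X k).compl) k)

/-- The mirror image of `leftLetter`. -/
def rightLetter (k : κ) (T : Module.End ℂ (X k).carrier) : Letters X →ₗ[ℂ] Tensors X :=
  (embed X k ∘ₗ T ∘ₗ (X k).compl.subtype) ∘ₗ
      DirectSum.component ℂ κ (fun k => (X k).compl) k +
    LinearMap.mulRight ℂ (embed X k (T (X k).vec)) ∘ₗ TensorAlgebra.ι ℂ ∘ₗ
      (LinearMap.id - DirectSum.lof ℂ κ (fun k => (X k).compl) k ∘ₗ
        DirectSum.component ℂ κ (fun k => (X k).compl) k)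

def leftMatrix (k : κ) (T : Module.End ℂ (X k).carrier) :
    Letters X →ₗ[ℂ] Matrix (Fin 2) (Fin 2) (Tensors X) where
  toFun v := !![TensorAlgebra.ι ℂ v, 0; leftLetter k T v, 0]
  map_add' v v' := by ext i j; fin_cases i <;> fin_cases j <;> simp
  map_smul' c v := by ext i j; fin_cases i <;> fin_cases j <;> simp

def rightMatrix (k : κ) (T : Module.End ℂ (X k).carrier) :
    Letters X →ₗ[ℂ] Matrix (Fin 2) (Fin 2) (Tensors X) where
  toFun v := !![TensorAlgebra.ι ℂ v, rightLetter k T v; 0, 0]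
  map_add' v v' := by ext i j; fin_cases i <;> fin_cases j <;> simp
  map_smul' c v := by ext i j; fin_cases i <;> fin_cases j <;> simp

/-- The linear map with `1 ↦ T ξ_k` and `v ⊗ u ↦ leftLetter k T v ⊗ u`
(see `leftMap_one`, `leftMap_ι_mul`). -/
def leftMap (k : κ) (T : Module.End ℂ (X k).carrier) : Tensors X →ₗ[ℂ] Tensors X :=
  (TensorAlgebra.algebraMapInv (R := ℂ) (M := Letters X)).toLinearMap.smulRight
      (embed X k (T (X k).vec)) +
    Matrix.entryLinearMap ℂ (Tensors X) 1 0 ∘ₗ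
      (TensorAlgebra.lift ℂ (leftMatrix k T)).toLinearMap

/-- The linear map with `1 ↦ T ξ_k` and `u ⊗ v ↦ u ⊗ rightLetter k T v`
(see `rightMap_one`, `rightMap_mul_ι`). -/
def rightMap (k : κ) (T : Module.End ℂ (X k).carrier) : Tensors X →ₗ[ℂ] Tensors X :=
  (TensorAlgebra.algebraMapInv (R := ℂ) (M := Letters X)).toLinearMap.smulRight
      (embed X k (T (X k).vec)) +
    Matrix.entryLinearMap ℂ (Tensors X) 0 1 ∘ₗ
      (TensorAlgebra.lift ℂ (rightMatrix k T)).toLinearMap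

theorem leftMap_one (k : κ) (T : Module.End ℂ (X k).carrier) :
    leftMap k T 1 = embed X k (T (X k).vec) := by
  simp [leftMap]

theorem rightMap_one (k : κ) (T : Module.End ℂ (X k).carrier) :
    rightMap k T 1 = embed X k (T (X k).vec) := by
  simp [rightMap]

theorem lift_leftMatrix (k : κ) (T : Module.End ℂ (X k).carrier) (u : Tensors X) :
    TensorAlgebra.lift ℂ (leftMatrix k T) u 0 0 = u ∧
      TensorAlgebra.lift ℂ (leftMatrix k T) u 0 1 = 0 := by
  induction u using TensorAlgebra.induction with
  | algebraMap r => simp [Matrix.algebraMap_matrix_apply]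
  | ι v => simp [leftMatrix]
  | mul a b ha hb => simp [Matrix.mul_apply, Fin.sum_univ_two, ha, hb]
  | add a b ha hb => simp [ha, hb]

theorem lift_rightMatrix (k : κ) (T : Module.End ℂ (X k).carrier) (u : Tensors X) :
    TensorAlgebra.lift ℂ (rightMatrix k T) u 0 0 = u ∧
      TensorAlgebra.lift ℂ (rightMatrix k T) u 1 0 = 0 := by
  induction u using TensorAlgebra.induction with
  | algebraMap r => simp [Matrix.algebraMap_matrix_apply]
  | ι v => simp [rightMatrix]
  | mul a b ha hb => simp [Matrix.mul_apply, Fin.sum_univ_two, ha, hb]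
  | add a b ha hb => simp [ha, hb]

theorem leftMap_ι_mul (k : κ) (T : Module.End ℂ (X k).carrier) (v : Letters X) (u : Tensors X) :
    leftMap k T (TensorAlgebra.ι ℂ v * u) = leftLetter k T v * u := by
  have h := (lift_leftMatrix k T u).1
  simp [leftMap, TensorAlgebra.algebraMapInv, Matrix.mul_apply, Fin.sum_univ_two, h]
  simp [leftMatrix]

theorem rightMap_mul_ι (k : κ) (T : Module.End ℂ (X k).carrier) (v : Letters X) (u : Tensors X) :
    rightMap k T (u * TensorAlgebra.ι ℂ v) = u * rightLetter k T v := by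
  have h := (lift_rightMatrix k T u).1
  simp [rightMap, TensorAlgebra.algebraMapInv, Matrix.mul_apply, Fin.sum_univ_two, h]
  simp [rightMatrix]

theorem leftMap_letter_same (k : κ) (T : Module.End ℂ (X k).carrier) (x : (X k).compl)
    (u : Tensors X) : leftMap k T (letter X k x * u) = embed X k (T x) * u := by
  simp [letter, leftMap_ι_mul, leftLetter]

theorem rightMap_letter_same (k : κ) (T : Module.End ℂ (X k).carrier) (x : (X k).compl)
    (u : Tensors X) : rightMap k T (u * letter X k x) = u * embed X k (T x) := by
  simp [letter, rightMap_mul_ι, rightLetter]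

theorem leftMap_letter_ne {j k : κ} (hjk : j ≠ k) (T : Module.End ℂ (X k).carrier)
    (x : (X j).compl) (u : Tensors X) :
    leftMap k T (letter X j x * u) = embed X k (T (X k).vec) * (letter X j x * u) := by
  simp [letter, leftMap_ι_mul, leftLetter, DirectSum.component.of, hjk, mul_assoc]

theorem rightMap_letter_ne {j k : κ} (hjk : j ≠ k) (T : Module.End ℂ (X k).carrier)
    (x : (X j).compl) (u : Tensors X) :
    rightMap k T (u * letter X j x) = u * letter X j x * embed X k (T (X k).vec) := by
  simp [letter, rightMap_mul_ι, rightLetter, DirectSum.component.of, hjk, mul_assoc]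

theorem tensorWord_cons (p : Σ k, (X k).compl) (l : List (Σ k, (X k).compl)) :
    tensorWord X (p :: l) = letter X p.1 p.2 * tensorWord X l := by
  simp [tensorWord]

theorem tensorWord_concat (p : Σ k, (X k).compl) (l : List (Σ k, (X k).compl)) :
    tensorWord X (l ++ [p]) = tensorWord X l * letter X p.1 p.2 := by
  simp [tensorWord]

theorem tensorWord_mem {l : List (Σ k, (X k).compl)} (hl : Alternating X l) :
    tensorWord X l ∈ freeSpace X :=
  Submodule.subset_span ⟨l, hl, rfl⟩

theorem embed_mul_word_mem {k : κ} (y : (X k).carrier) {l : List (Σ k, (X k).compl)}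
    (hl : Alternating X l) (h : Alternating X (⟨k, (X k).proj y⟩ :: l)) :
    embed X k y * tensorWord X l ∈ freeSpace X := by
  have h1 := tensorWord_mem h
  rw [tensorWord_cons] at h1
  simpa [embed, add_mul] using
    (freeSpace X).add_mem ((freeSpace X).smul_mem ((X k).state y) (tensorWord_mem hl)) h1

theorem word_mul_embed_mem {k : κ} (y : (X k).carrier) {l : List (Σ k, (X k).compl)}
    (hl : Alternating X l) (h : Alternating X (l ++ [⟨k, (X k).proj y⟩])) :
    tensorWord X l * embed X k y ∈ freeSpace X := by
  have h1 := tensorWord_mem h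
  rw [tensorWord_concat] at h1
  simpa [embed, mul_add] using
    (freeSpace X).add_mem ((freeSpace X).smul_mem ((X k).state y) (tensorWord_mem hl)) h1

theorem leftMap_mem (k : κ) (T : Module.End ℂ (X k).carrier) :
    ∀ u ∈ freeSpace X, leftMap k T u ∈ freeSpace X := by
  intro u hu
  induction hu using Submodule.span_induction with
  | mem u hu =>
    obtain ⟨l, hl, rfl⟩ := hu
    rcases l with _ | ⟨⟨j, x⟩, l⟩
    · simpa [tensorWord, leftMap_one] using
        embed_mul_word_mem (T (X k).vec) (l := []) hl (by simp [Alternating])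
    · rcases eq_or_ne j k with rfl | hjk
      · rw [tensorWord_cons, leftMap_letter_same]
        refine embed_mul_word_mem _ ?_ (by simpa [Alternating] using hl)
        simp only [Set.mem_ofPred_eq, Alternating, List.map_cons] at hl ⊢
        exact hl.tail
      · rw [tensorWord_cons, leftMap_letter_ne hjk, ← tensorWord_cons ⟨j, x⟩ l]
        refine embed_mul_word_mem _ hl ?_
        simp only [Set.mem_ofPred_eq, Alternating, List.map_cons] at hl ⊢
        exact List.IsChain.cons_cons hjk.symm hl
  | zero => simp
  | add a b _ _ ha hb => rw [map_add]; exact (freeSpace X).add_mem ha hb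
  | smul c a _ ha => rw [map_smul]; exact (freeSpace X).smul_mem c ha

theorem rightMap_mem (k : κ) (T : Module.End ℂ (X k).carrier) :
    ∀ u ∈ freeSpace X, rightMap k T u ∈ freeSpace X := by
  intro u hu
  induction hu using Submodule.span_induction with
  | mem u hu =>
    obtain ⟨l, hl, rfl⟩ := hu
    rcases List.eq_nil_or_concat l with rfl | ⟨l, ⟨j, x⟩, rfl⟩
    · simpa [tensorWord, rightMap_one] using
        word_mul_embed_mem (T (X k).vec) (l := []) hl (by simp [Alternating])
    · rw [List.concat_eq_append] at hl ⊢
      rcases eq_or_ne j k with rfl | hjk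
      · rw [tensorWord_concat, rightMap_letter_same]
        refine word_mul_embed_mem _ ?_ (by simpa [Alternating] using hl)
        simp only [Set.mem_ofPred_eq, Alternating, List.map_append] at hl ⊢
        exact hl.left_of_append
      · rw [tensorWord_concat, rightMap_letter_ne hjk, ← tensorWord_concat ⟨j, x⟩ l]
        refine word_mul_embed_mem _ hl ?_
        simp only [Set.mem_ofPred_eq, Alternating, List.map_append] at hl ⊢
        refine List.IsChain.append hl (by simp) ?_
        simp [hjk]
  | zero => simp
  | add a b _ _ ha hb => rw [map_add]; exact (freeSpace X).add_mem ha hb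
  | smul c a _ ha => rw [map_smul]; exact (freeSpace X).smul_mem c ha

/-- The left representation `λ_k` of the operators on the `k`-th space on the free product:
`T ⊗ 1` with respect to the decomposition of the free product as `X_k ⊗ X(ℓ, k)`, where `X(ℓ, k)`
is spanned by the alternating tensors that do not begin in the `k`-th complement. -/
def leftRep (k : κ) (T : Module.End ℂ (X k).carrier) : Module.End ℂ (freeProduct X).carrier :=
  (leftMap k T).restrict (leftMap_mem k T)

/-- The right representation `ρ_k`: `1 ⊗ T` with respect to the decomposition of the free product
as `X(r, k) ⊗ X_k`, where `X(r, k)` is spanned by the alternating tensors that do not end in the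
`k`-th complement. -/
def rightRep (k : κ) (T : Module.End ℂ (X k).carrier) : Module.End ℂ (freeProduct X).carrier :=
  (rightMap k T).restrict (rightMap_mem k T)

end FreeProduct

/-! ### Bi-freeness -/

/-- The joint distribution of the families `a`, `b` of left and right variables in `(A, φ)`, as a
functional on noncommutative polynomials. -/
def jointDistribution {A : Type u} [Ring A] [Algebra ℂ A] (φ : A →ₗ[ℂ] ℂ) {κ : Type w}
    (a b : κ → A) : FreeAlgebra ℂ (κ ⊕ κ) →ₗ[ℂ] ℂ :=
  φ ∘ₗ (FreeAlgebra.lift ℂ (Sum.elim a b)).toLinearMap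

/-- The vector functional of the specified vector on the operators of a pointed space. -/
def vectorState (E : PointedSpace.{v}) : Module.End ℂ E.carrier →ₗ[ℂ] ℂ :=
  E.state ∘ₗ LinearMap.applyₗ E.vec

/-- Bi-freeness of the two-faced pairs `(a k, b k)`: there are spaces with specified vectors `X k`
and operators `L k`, `R k` on them such that the variables `a k`, `b k` have the same joint
distribution as the operators `λ_k (L k)`, `ρ_k (R k)` on the free product of the `X k`.
(A unital homomorphism from the face `ℂ⟨x⟩` into the operators on `X k` is the same as an operator
on `X k`.) -/
def IsBiFree {A : Type u} [Ring A] [Algebra ℂ A] (φ : A →ₗ[ℂ] ℂ) {κ : Type w} [DecidableEq κ]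
    (a b : κ → A) : Prop :=
  ∃ (X : κ → PointedSpace.{v}) (L R : ∀ k, Module.End ℂ (X k).carrier),
    jointDistribution φ a b = jointDistribution (vectorState (freeProduct X))
      (fun k => leftRep k (L k)) (fun k => rightRep k (R k))

/-! ### Transforms -/

section Transforms

variable {A : Type u} [NormedRing A] [NormedAlgebra ℂ A] (φ : A →L[ℂ] ℂ)

/-- `G_a(z) = φ((z1 - a)⁻¹)`. -/
def cauchyG (a : A) (z : ℂ) : ℂ := φ (Ring.inverse (z • (1 : A) - a))

/-- `ψ_b(s) = φ((1 - sb)⁻¹) - 1`. -/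
def psi (b : A) (s : ℂ) : ℂ := φ (Ring.inverse (1 - s • b)) - 1

/-- `F_{a,b}(t,s) = φ((t1 - a)⁻¹ (1 - sb)⁻¹)`. -/
def mixedF (a b : A) (t s : ℂ) : ℂ :=
  φ (Ring.inverse (t • (1 : A) - a) * Ring.inverse (1 - s • b))

/-- `K` is, as a germ at `0`, the inverse of `G_a` (which is a local bijection from a neighbourhood
of `∞` onto a neighbourhood of `0`). -/
def IsInverseG (a : A) (K : ℂ → ℂ) : Prop :=
  Tendsto K (𝓝[≠] 0) (Bornology.cobounded ℂ) ∧ ∀ᶠ z in 𝓝[≠] 0, cauchyG φ a (K z) = z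

/-- `χ` is, as a germ at `0`, the inverse of `ψ_b` (which vanishes at `0`). -/
def IsInversePsi (b : A) (χ : ℂ → ℂ) : Prop :=
  Tendsto χ (𝓝 0) (𝓝 0) ∧ ∀ᶠ w in 𝓝 0, psi φ b (χ w) = w

variable [CompleteSpace A]

theorem hasStrictDerivAt_h (a : A) :
    HasStrictDerivAt (fun t : ℂ => φ (Ring.inverse (1 - t • a))) (φ a) 0 := by
  have h1 : HasStrictDerivAt (fun t : ℂ => 1 - t • a) (-a) 0 := by
    simpa using ((hasStrictDerivAt_id (0 : ℂ)).smul_const a).const_sub (1 : A)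
  have h2 := hasStrictFDerivAt_ringInverse (𝕜 := ℂ) (1 : Aˣ)
  rw [show ((1 : Aˣ) : A) = 1 - (0 : ℂ) • a by simp] at h2
  have h3 := HasStrictFDerivAt.comp_hasStrictDerivAt (0 : ℂ)
    (φ.hasStrictFDerivAt (x := Ring.inverse (1 - (0 : ℂ) • a)))
    (h2.comp_hasStrictDerivAt (0 : ℂ) h1)
  have h4 : φ ((-((ContinuousLinearMap.mulLeftRight ℂ A) ↑(1 : Aˣ)⁻¹) ↑(1 : Aˣ)⁻¹) (-a)) = φ a := by
    simp
  rw [h4] at h3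
  exact h3

theorem exists_isInversePsi (hφ : φ 1 = 1) (b : A) (hb : φ b ≠ 0) :
    ∃ χ : ℂ → ℂ, IsInversePsi φ b χ := by
  have h : HasStrictDerivAt (psi φ b) (φ b) 0 := (hasStrictDerivAt_h φ b).sub_const 1
  have h0 : psi φ b 0 = 0 := by simp [psi, hφ]
  refine ⟨h.localInverse (psi φ b) (φ b) 0 hb, ?_, ?_⟩
  · have h1 := (h.to_localInverse hb).hasDerivAt.continuousAt.tendsto
    have h2 : h.localInverse (psi φ b) (φ b) 0 hb (psi φ b 0) = 0 :=
      (h.hasStrictFDerivAt_equiv hb).localInverse_apply_image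
    rwa [h2, h0] at h1
  · have h1 := (h.hasStrictFDerivAt_equiv hb).eventually_right_inverse
    rwa [h0] at h1

theorem exists_isInverseG (hφ : φ 1 = 1) (a : A) : ∃ K : ℂ → ℂ, IsInverseG φ a K := by
  have h : HasStrictDerivAt (fun t : ℂ => t * φ (Ring.inverse (1 - t • a))) 1 0 := by
    have h1 := (hasStrictDerivAt_id (0 : ℂ)).mul (hasStrictDerivAt_h φ a)
    have h2 : (1 : ℂ) * φ (Ring.inverse (1 - (0 : ℂ) • a)) + id (0 : ℂ) * φ a = 1 := by simp [hφ]
    rw [h2] at h1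
    exact h1
  set g : ℂ → ℂ := fun t => t * φ (Ring.inverse (1 - t • a)) with hg
  have h0 : g 0 = 0 := by simp [hg]
  set k := h.localInverse g 1 0 one_ne_zero with hk
  have hk0 : Tendsto k (𝓝 0) (𝓝 0) := by
    have h1 := (h.to_localInverse one_ne_zero).hasDerivAt.continuousAt.tendsto
    have h2 : h.localInverse g 1 0 one_ne_zero (g 0) = 0 :=
      (h.hasStrictFDerivAt_equiv one_ne_zero).localInverse_apply_image
    rwa [h2, h0] at h1
  have hgk : ∀ᶠ z in 𝓝 0, g (k z) = z := by
    have h1 := (h.hasStrictFDerivAt_equiv one_ne_zero).eventually_right_inverse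
    rwa [h0] at h1
  have hgk' : ∀ᶠ z in 𝓝[≠] 0, g (k z) = z ∧ k z ≠ 0 := by
    filter_upwards [hgk.filter_mono nhdsWithin_le_nhds, self_mem_nhdsWithin] with z hz hz0
    refine ⟨hz, fun hkz => hz0 ?_⟩
    rw [Set.mem_singleton_iff, ← hz, hkz, h0]
  refine ⟨fun z => (k z)⁻¹, ?_, ?_⟩
  · refine tendsto_inv₀_nhdsNE_zero.comp (tendsto_nhdsWithin_iff.2 ⟨?_, ?_⟩)
    · exact hk0.mono_left nhdsWithin_le_nhds
    · filter_upwards [hgk'] with z hz using hz.2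
  · filter_upwards [hgk'] with z hz
    have hu : (k z)⁻¹ • (1 : A) - a = ((k z)⁻¹ • (1 : A)) * (1 - k z • a) := by
      rw [smul_mul_assoc, one_mul, smul_sub, smul_smul, inv_mul_cancel₀ hz.2, one_smul]
    have h1 : ((k z)⁻¹ • (1 : A)) * (k z • (1 : A)) = 1 := by
      rw [smul_mul_smul_comm, inv_mul_cancel₀ hz.2, one_smul, one_mul]
    have h2 : (k z • (1 : A)) * ((k z)⁻¹ • (1 : A)) = 1 := by
      rw [smul_mul_smul_comm, mul_inv_cancel₀ hz.2, one_smul, one_mul]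
    have hc : IsUnit ((k z)⁻¹ • (1 : A)) := ⟨⟨_, _, h1, h2⟩, rfl⟩
    have hi : Ring.inverse ((k z)⁻¹ • (1 : A)) = k z • (1 : A) := by
      have h3 := Ring.inverse_mul_cancel _ hc
      calc _ = Ring.inverse ((k z)⁻¹ • (1 : A)) * (((k z)⁻¹ • (1 : A)) * (k z • (1 : A))) := by
            rw [h1, mul_one]
        _ = _ := by rw [← mul_assoc, h3, one_mul]
    have hgz := hz.1
    rw [cauchyG, hu, Ring.inverse_mul (Or.inl hc), hi, mul_smul_comm, mul_one, map_smul,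
      smul_eq_mul]
    exact hgz

/-- `K_a`, the inverse of `G_a` near `0`. -/
def invG (hφ : φ 1 = 1) (a : A) : ℂ → ℂ := (exists_isInverseG φ hφ a).choose

/-- `𝒳_b`, the inverse of `ψ_b` near `0`, defined when `φ(b) ≠ 0`. -/
def invPsi (hφ : φ 1 = 1) (b : A) (hb : φ b ≠ 0) : ℂ → ℂ := (exists_isInversePsi φ hφ b hb).choose

/-- The partial bi-free `T`-transform, defined when `φ(b) ≠ 0`. -/
def tTransform (hφ : φ 1 = 1) (a b : A) (hb : φ b ≠ 0) (z w : ℂ) : ℂ :=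
  (w + 1) / w * (1 - z / mixedF φ a b (invG φ hφ a z) (invPsi φ hφ b hb w))

end Transforms

end BiFree

end

namespace BiFree

/-! ### Alternating words of centred operators on the free product. -/

section WordPairing

variable {κ : Type w} [DecidableEq κ] {X : κ → PointedSpace.{v}}

/-! Write `α k = z⁻¹(K_k(z) - a_k)⁻¹ - 1` and `β k = (1 - 𝒳_k(w) b_k)⁻¹ - (1 + w)`. By the choice of
`K_k` and `𝒳_k` these elements are centred, and as limits of polynomials they lie in the closed
algebras generated by `a_k` and `b_k`.

The only consequence of bi-freeness that is used is a pairing of words. On the free product, an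
alternating product of centred right operators turns the specified vector into an elementary tensor.
An alternating product of centred left operators can return from it to the specified vector only by
removing the letters one at a time. Hence `φ` of an alternating word in `α` times an alternating
word in `β` vanishes unless the two index words coincide, and then it is the product of the numbers
`φ(α k * β k)` (`vectorState_leftRep_prod_mul_rightRep_prod`, extended to closures in
`IsBiFree.map_prod_mul_prod`).

Both resolvents in the mixed transform of the combined pair are weighted sums of all alternating
words. At `K_1 + K_2 - z⁻¹` the resolvent of the sum is `z` times such a series in `α`
(`ringInverse_smul_one_sub_add`). At `𝒳_1 𝒳_2 (1 + w)/w` the resolvent of the product is `1 + w`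
times such a series in `β` (`ringInverse_one_sub_smul_mul`). Only the empty word contributes to `φ`
of a single series, so these points are values of the inverse germs of the sum and of the product,
by local uniqueness.

In `φ` of the product of the two series only the diagonal survives. It is a geometric series in `φ(α
0 * β 0) φ(α 1 * β 1)` (`map_altSeries_mul_altSeries`). With the values `z(1 + w + φ(α k * β k))` of
the individual mixed transforms, the multiplicativity becomes the rational identity
`tTransform_identity`. -/

theorem proj_vec (E : PointedSpace.{v}) : E.proj E.vec = 0 := by
  ext
  simp [PointedSpace.coe_proj, E.state_vec]

theorem proj_coe (E : PointedSpace.{v}) (x : E.compl) : E.proj x = x := by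
  ext
  have hx : E.state x = 0 := x.2
  simp [PointedSpace.coe_proj, hx]

theorem embed_apply (k : κ) (y : (X k).carrier) :
    embed X k y = (X k).state y • 1 + letter X k ((X k).proj y) := rfl

theorem embed_vec (k : κ) : embed X k (X k).vec = 1 := by
  simp [embed_apply, proj_vec, (X k).state_vec]

theorem embed_coe (k : κ) (x : (X k).compl) : embed X k x = letter X k x := by
  have hx : (X k).state x = 0 := x.2
  simp [embed_apply, proj_coe, hx]

theorem embed_of_state_eq_zero {k : κ} {y : (X k).carrier} (hy : (X k).state y = 0) :
    embed X k y = letter X k ((X k).proj y) := by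
  simp [embed_apply, hy]

theorem algebraMapInv_letter_mul (k : κ) (x : (X k).compl) (u : Tensors X) :
    TensorAlgebra.algebraMapInv (letter X k x * u) = 0 := by
  simp [letter, TensorAlgebra.algebraMapInv]

theorem algebraMapInv_embed (k : κ) (y : (X k).carrier) :
    TensorAlgebra.algebraMapInv (embed X k y) = (X k).state y := by
  have := algebraMapInv_letter_mul k ((X k).proj y) 1
  rw [mul_one] at this
  simp [embed_apply, this]

/-- This is the formula `T ⊗ 1` on `X_k ⊗ X(ℓ, k)`. It treats the specified vector and its
complement together, which spares later case distinctions. -/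
theorem leftMap_embed_mul (k : κ) (T : Module.End ℂ (X k).carrier) (y : (X k).carrier)
    {l : List (Σ k, (X k).compl)} (hl : ∀ p ∈ l.head?, p.1 ≠ k) :
    leftMap k T (embed X k y * tensorWord X l) = embed X k (T y) * tensorWord X l := by
  have h1 : leftMap k T (tensorWord X l) = embed X k (T (X k).vec) * tensorWord X l := by
    rcases l with _ | ⟨⟨j, x⟩, l⟩
    · simp [tensorWord, leftMap_one]
    · rw [tensorWord_cons]
      exact leftMap_letter_ne (hl ⟨j, x⟩ (by simp)) T x _
  have h2 : y = (X k).state y • (X k).vec + ((X k).proj y : (X k).carrier) := by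
    simp [PointedSpace.coe_proj]
  rw [embed_apply k y, add_mul, smul_mul_assoc, one_mul, map_add, map_smul, h1,
    leftMap_letter_same, ← smul_mul_assoc, ← add_mul, ← map_smul, ← map_smul, ← map_add,
    ← map_add, ← h2]

theorem rightMap_mul_embed (k : κ) (T : Module.End ℂ (X k).carrier) (y : (X k).carrier)
    {l : List (Σ k, (X k).compl)} (hl : ∀ p ∈ l.getLast?, p.1 ≠ k) :
    rightMap k T (tensorWord X l * embed X k y) = tensorWord X l * embed X k (T y) := by
  have h1 : rightMap k T (tensorWord X l) = tensorWord X l * embed X k (T (X k).vec) := by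
    rcases List.eq_nil_or_concat l with rfl | ⟨l, ⟨j, x⟩, rfl⟩
    · simp [tensorWord, rightMap_one]
    · rw [List.concat_eq_append, tensorWord_concat]
      exact rightMap_letter_ne (hl ⟨j, x⟩ (by simp)) T x _
  have h2 : y = (X k).state y • (X k).vec + ((X k).proj y : (X k).carrier) := by
    simp [PointedSpace.coe_proj]
  rw [embed_apply k y, mul_add, mul_smul_comm, mul_one, map_add, map_smul, h1,
    rightMap_letter_same, ← mul_smul_comm, ← mul_add, ← map_smul, ← map_smul, ← map_add,
    ← map_add, ← h2]

/-- The identification of the free product with `X_k ⊗ X(ℓ, k)`, in the form of a spanning set.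
Restricting to alternating tensors matters: `leftMap k` is not multiplicative on all tensors, since
the scalar part of `T x` in `T x ⊗ x'` would expose a second letter of index `k`. -/
theorem eqOn_freeSpace_of_embed_mul (k : κ) {f g : Tensors X →ₗ[ℂ] Tensors X}
    (h : ∀ (y : (X k).carrier) (l : List (Σ k, (X k).compl)), (∀ p ∈ l.head?, p.1 ≠ k) →
      f (embed X k y * tensorWord X l) = g (embed X k y * tensorWord X l)) :
    Set.EqOn f g (freeSpace X) := by
  refine LinearMap.eqOn_span' ?_
  rintro _ ⟨l, hl, rfl⟩
  -- A word not beginning in `k` is its own product with the embedded specified vector `1`;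
  -- otherwise its first letter is split off.
  by_cases hk : ∀ p ∈ l.head?, p.1 ≠ k
  · simpa [embed_vec] using h (X k).vec l hk
  · rcases l with _ | ⟨⟨j, x⟩, l⟩
    · simp at hk
    · obtain rfl : j = k := by simpa using hk
      rw [tensorWord_cons, ← embed_coe]
      refine h x l fun p hp => ?_
      simp only [Set.mem_ofPred_eq, Alternating, List.map_cons] at hl
      rcases l with _ | ⟨q, l⟩
      · simp at hp
      · obtain rfl : q = p := by simpa using hp
        simp only [List.map_cons, List.isChain_cons_cons] at hl
        exact hl.1.symm

theorem eqOn_freeSpace_of_mul_embed (k : κ) {f g : Tensors X →ₗ[ℂ] Tensors X}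
    (h : ∀ (y : (X k).carrier) (l : List (Σ k, (X k).compl)), (∀ p ∈ l.getLast?, p.1 ≠ k) →
      f (tensorWord X l * embed X k y) = g (tensorWord X l * embed X k y)) :
    Set.EqOn f g (freeSpace X) := by
  refine LinearMap.eqOn_span' ?_
  rintro _ ⟨l, hl, rfl⟩
  by_cases hk : ∀ p ∈ l.getLast?, p.1 ≠ k
  · simpa [embed_vec] using h (X k).vec l hk
  · rcases List.eq_nil_or_concat l with rfl | ⟨l, ⟨j, x⟩, rfl⟩
    · simp at hk
    · obtain rfl : j = k := by simpa using hk
      rw [List.concat_eq_append] at hl ⊢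
      rw [tensorWord_concat, ← embed_coe]
      refine h x l fun p hp => ?_
      simp only [Set.mem_ofPred_eq, Alternating, List.map_append, List.isChain_append] at hl
      exact hl.2.2 p.1 (by rw [List.getLast?_map, Option.mem_def.1 hp]; rfl) j (by simp)

/-- `leftRep` as a homomorphism of algebras. -/
noncomputable def leftRepHom (k : κ) :
    Module.End ℂ (X k).carrier →ₐ[ℂ] Module.End ℂ (freeProduct X).carrier :=
  AlgHom.ofLinearMap
    { toFun := leftRep k
      map_add' := fun S T => LinearMap.ext fun u => Subtype.ext <|
        eqOn_freeSpace_of_embed_mul k (f := leftMap k (S + T)) (g := leftMap k S + leftMap k T)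
          (fun y l hl => by simp [leftMap_embed_mul k _ _ hl, add_mul]) u.2
      map_smul' := fun c T => LinearMap.ext fun u => Subtype.ext <|
        eqOn_freeSpace_of_embed_mul k (f := leftMap k (c • T)) (g := c • leftMap k T)
          (fun y l hl => by simp [leftMap_embed_mul k _ _ hl]) u.2 }
    (LinearMap.ext fun u => Subtype.ext <|
      eqOn_freeSpace_of_embed_mul k (f := leftMap k 1) (g := LinearMap.id)
        (fun y l hl => by simp [leftMap_embed_mul k _ _ hl]) u.2)
    (fun S T => LinearMap.ext fun u => Subtype.ext <|
      eqOn_freeSpace_of_embed_mul k (f := leftMap k (S * T)) (g := leftMap k S ∘ₗ leftMap k T)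
        (fun y l hl => by simp [leftMap_embed_mul k _ _ hl]) u.2)

/-- `rightRep` as a homomorphism of algebras. -/
noncomputable def rightRepHom (k : κ) :
    Module.End ℂ (X k).carrier →ₐ[ℂ] Module.End ℂ (freeProduct X).carrier :=
  AlgHom.ofLinearMap
    { toFun := rightRep k
      map_add' := fun S T => LinearMap.ext fun u => Subtype.ext <|
        eqOn_freeSpace_of_mul_embed k (f := rightMap k (S + T)) (g := rightMap k S + rightMap k T)
          (fun y l hl => by simp [rightMap_mul_embed k _ _ hl, mul_add]) u.2
      map_smul' := fun c T => LinearMap.ext fun u => Subtype.ext <|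
        eqOn_freeSpace_of_mul_embed k (f := rightMap k (c • T)) (g := c • rightMap k T)
          (fun y l hl => by simp [rightMap_mul_embed k _ _ hl]) u.2 }
    (LinearMap.ext fun u => Subtype.ext <|
      eqOn_freeSpace_of_mul_embed k (f := rightMap k 1) (g := LinearMap.id)
        (fun y l hl => by simp [rightMap_mul_embed k _ _ hl]) u.2)
    (fun S T => LinearMap.ext fun u => Subtype.ext <|
      eqOn_freeSpace_of_mul_embed k (f := rightMap k (S * T)) (g := rightMap k S ∘ₗ rightMap k T)
        (fun y l hl => by simp [rightMap_mul_embed k _ _ hl]) u.2)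

theorem vectorState_leftRep (k : κ) (T : Module.End ℂ (X k).carrier) :
    vectorState (freeProduct X) (leftRep k T) = (X k).state (T (X k).vec) := by
  change TensorAlgebra.algebraMapInv (leftMap k T 1) = _
  rw [leftMap_one, algebraMapInv_embed]

theorem vectorState_rightRep (k : κ) (T : Module.End ℂ (X k).carrier) :
    vectorState (freeProduct X) (rightRep k T) = (X k).state (T (X k).vec) := by
  change TensorAlgebra.algebraMapInv (rightMap k T 1) = _
  rw [rightMap_one, algebraMapInv_embed]

/-- An alternating product of centred right operators maps the specified vector to the elementary
tensor of the vectors `U j ξ_j`, in reversed order. -/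
theorem rightRep_prod_vec (U : ∀ k, Module.End ℂ (X k).carrier)
    (hU : ∀ k, (X k).state (U k (X k).vec) = 0) {l : List κ} (hl : l.IsChain (· ≠ ·)) :
    (freeSpace X).subtype ((l.map fun k => rightRep k (U k)).prod (freeProduct X).vec) =
      tensorWord X (l.reverse.map fun k => ⟨k, (X k).proj (U k (X k).vec)⟩) := by
  induction l with
  | nil => simp [tensorWord]; rfl
  | cons j l ih =>
    rw [List.map_cons, List.prod_cons, List.reverse_cons, List.map_append]
    change rightMap j (U j)
      ((freeSpace X).subtype ((l.map fun k => rightRep k (U k)).prod (freeProduct X).vec)) = _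
    rw [ih hl.tail]
    have h := rightMap_mul_embed j (U j) (X j).vec
      (l := l.reverse.map fun k => ⟨k, (X k).proj (U k (X k).vec)⟩) (by
        intro p hp
        rcases l with _ | ⟨i, l⟩
        · simp at hp
        · obtain rfl : _ = p := by simpa using hp
          exact (List.isChain_cons_cons.1 hl).1.symm)
    rw [embed_vec, mul_one] at h
    rw [h, List.map_singleton, tensorWord_concat, embed_of_state_eq_zero (hU j)]

/-- The functional of an alternating product of centred left operators, read with the operator
acting first at the end of the list, on an elementary tensor. -/
theorem algebraMapInv_leftMap_prod (T : ∀ k, Module.End ℂ (X k).carrier)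
    (hT : ∀ k, (X k).state (T k (X k).vec) = 0) (l : List κ) :
    l.IsChain (· ≠ ·) → ∀ (r : List (Σ k, (X k).compl)),
    TensorAlgebra.algebraMapInv ((l.reverse.map fun k => leftMap k (T k)).prod (tensorWord X r)) =
      if l = r.map Sigma.fst then (r.map fun p => (X p.1).state (T p.1 p.2)).prod else 0 := by
  induction l with
  | nil =>
    intro _ r
    rcases r with _ | ⟨p, r⟩
    · simp [tensorWord]
    · simp [tensorWord_cons, algebraMapInv_letter_mul]
  | cons i l ih =>
    intro hl r
    -- If the operator of index `i` leaves a letter of index `i` in front, the functional vanishes: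
    -- by induction the next operator would need the index `i`, which alternation excludes.
    have key : ∀ (y : (X i).compl) (r : List (Σ k, (X k).compl)),
        TensorAlgebra.algebraMapInv
          ((l.reverse.map fun k => leftMap k (T k)).prod (letter X i y * tensorWord X r)) = 0 := by
      intro y r
      rw [← tensorWord_cons ⟨i, y⟩ r, ih hl.tail, if_neg]
      rintro rfl
      exact (List.isChain_cons_cons.1 hl).1 rfl
    rw [List.reverse_cons, List.map_append, List.prod_append, List.map_singleton,
      List.prod_singleton, Module.End.mul_apply]
    rcases r with _ | ⟨⟨j, y⟩, r⟩
    · have := key ((X i).proj (T i (X i).vec)) []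
      simp only [tensorWord, List.map_nil, List.prod_nil, mul_one] at this
      simpa [tensorWord, leftMap_one, embed_of_state_eq_zero (hT i)] using this
    · rw [tensorWord_cons]
      -- For equal indices the scalar part of `T y` removes the first letter, and the rest is killed
      -- by `key`. For different indices a new letter is added in front, and `key` kills everything.
      rcases eq_or_ne j i with rfl | hji
      · rw [leftMap_letter_same, embed_apply, add_mul, map_add, map_add, key, add_zero,
          smul_mul_assoc, one_mul, map_smul, map_smul, ih hl.tail]
        simp
      · rw [leftMap_letter_ne hji, embed_of_state_eq_zero (hT i), ← tensorWord_cons ⟨j, y⟩ r, key,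
          if_neg]
        simp [hji.symm]

theorem coe_leftRep_prod (T : ∀ k, Module.End ℂ (X k).carrier) (l : List κ) (u : freeSpace X) :
    (freeSpace X).subtype ((l.map fun k => leftRep k (T k)).prod u) =
      (l.map fun k => leftMap k (T k)).prod (u : Tensors X) := by
  induction l with
  | nil => rfl
  | cons i l ih =>
    rw [List.map_cons, List.map_cons, List.prod_cons, List.prod_cons]
    change leftMap i (T i) _ = leftMap i (T i) _
    exact congrArg _ ih

/-- The joint moments of alternating products of centred left and right operators. -/
theorem vectorState_leftRep_prod_mul_rightRep_prod (T U : ∀ k, Module.End ℂ (X k).carrier)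
    (hT : ∀ k, (X k).state (T k (X k).vec) = 0) (hU : ∀ k, (X k).state (U k (X k).vec) = 0)
    {l r : List κ} (hl : l.IsChain (· ≠ ·)) (hr : r.IsChain (· ≠ ·)) :
    vectorState (freeProduct X) ((l.map fun k => leftRep k (T k)).prod *
        (r.map fun k => rightRep k (U k)).prod) =
      if l = r then (l.map fun k => (X k).state (T k (U k (X k).vec))).prod else 0 := by
  have h1 : ∀ k, (X k).state (T k ((X k).proj (U k (X k).vec))) =
      (X k).state (T k (U k (X k).vec)) := by
    intro k
    simp [PointedSpace.coe_proj, hU k]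
  refine (congrArg TensorAlgebra.algebraMapInv ((coe_leftRep_prod T l
    ((r.map fun k => rightRep k (U k)).prod (freeProduct X).vec)).trans
      (congrArg (l.map fun k => leftMap k (T k)).prod (rightRep_prod_vec U hU hr)))).trans ?_
  -- Both words are reversed, one by the order in which operators act and the other by the order of
  -- the tensor factors, so the condition becomes `l = r` again.
  have hl' : l.reverse.IsChain (· ≠ ·) := by
    rw [List.isChain_reverse]
    simpa [ne_comm] using hl
  have := algebraMapInv_leftMap_prod T hT l.reverse hl'
    (r.reverse.map fun k => ⟨k, (X k).proj (U k (X k).vec)⟩)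
  rw [List.reverse_reverse] at this
  rw [this, List.map_map, List.map_map]
  have h2 : (Sigma.fst ∘ fun k => (⟨k, (X k).proj (U k (X k).vec)⟩ : Σ k, (X k).compl)) = id := rfl
  simp only [h2, List.map_id, List.reverse_inj]
  split_ifs with h
  · subst h
    simp only [Function.comp_def, h1, List.map_reverse, List.prod_reverse]
  · rfl

end WordPairing

/-! ### Transfer of the word pairing to the algebra and to closed subalgebras. -/

section Moments

variable {κ : Type w}

theorem jointDistribution_word {A : Type u} [Ring A] [Algebra ℂ A] (φ : A →ₗ[ℂ] ℂ) (a b : κ → A)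
    (f g : κ → Polynomial ℂ) (l r : List κ) :
    jointDistribution φ a b
        ((l.map fun k => Polynomial.aeval (FreeAlgebra.ι ℂ (Sum.inl k)) (f k)).prod *
          (r.map fun k => Polynomial.aeval (FreeAlgebra.ι ℂ (Sum.inr k)) (g k)).prod) =
      φ ((l.map fun k => Polynomial.aeval (a k) (f k)).prod *
        (r.map fun k => Polynomial.aeval (b k) (g k)).prod) := by
  simp [jointDistribution, map_list_prod, Function.comp_def, ← Polynomial.aeval_algHom_apply]

variable [DecidableEq κ]

theorem aeval_leftRep {X : κ → PointedSpace.{v}} (k : κ) (T : Module.End ℂ (X k).carrier)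
    (f : Polynomial ℂ) :
    Polynomial.aeval (leftRep k T) f = leftRep k (Polynomial.aeval T f) :=
  Polynomial.aeval_algHom_apply (leftRepHom k) T f

theorem aeval_rightRep {X : κ → PointedSpace.{v}} (k : κ) (T : Module.End ℂ (X k).carrier)
    (f : Polynomial ℂ) :
    Polynomial.aeval (rightRep k T) f = rightRep k (Polynomial.aeval T f) :=
  Polynomial.aeval_algHom_apply (rightRepHom k) T f

/-- For bi-free pairs, the moments of alternating products of centred polynomials. -/
theorem IsBiFree.map_aeval_prod_mul_prod {A : Type u} [Ring A] [Algebra ℂ A] {φ : A →ₗ[ℂ] ℂ}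
    {a b : κ → A} (h : IsBiFree.{u, v, w} φ a b) (f g : κ → Polynomial ℂ)
    (hf : ∀ k, φ (Polynomial.aeval (a k) (f k)) = 0)
    (hg : ∀ k, φ (Polynomial.aeval (b k) (g k)) = 0)
    {l r : List κ} (hl : l.IsChain (· ≠ ·)) (hr : r.IsChain (· ≠ ·)) :
    φ ((l.map fun k => Polynomial.aeval (a k) (f k)).prod *
        (r.map fun k => Polynomial.aeval (b k) (g k)).prod) =
      if l = r then (l.map fun k => φ (Polynomial.aeval (a k) (f k) *
        Polynomial.aeval (b k) (g k))).prod else 0 := by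
  obtain ⟨X, L, R, hX⟩ := h
  have key : ∀ l r : List κ, φ ((l.map fun k => Polynomial.aeval (a k) (f k)).prod *
      (r.map fun k => Polynomial.aeval (b k) (g k)).prod) =
      vectorState (freeProduct X) ((l.map fun k => leftRep k (Polynomial.aeval (L k) (f k))).prod *
        (r.map fun k => rightRep k (Polynomial.aeval (R k) (g k))).prod) := by
    intro l r
    rw [← jointDistribution_word, hX, jointDistribution_word]
    simp only [aeval_leftRep, aeval_rightRep]
  -- Words of length one carry the centring from the algebra to the spaces `X k`; the pair `[k]`,
  -- `[k]` below does the same for the mixed moments.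
  have hT : ∀ k, (X k).state (Polynomial.aeval (L k) (f k) (X k).vec) = 0 := by
    intro k
    have := key [k] []
    simpa [vectorState_leftRep, hf] using this.symm
  have hU : ∀ k, (X k).state (Polynomial.aeval (R k) (g k) (X k).vec) = 0 := by
    intro k
    have := key [] [k]
    simpa [vectorState_rightRep, hg] using this.symm
  have hm := fun {l r : List κ} => vectorState_leftRep_prod_mul_rightRep_prod
    (fun k => Polynomial.aeval (L k) (f k)) (fun k => Polynomial.aeval (R k) (g k)) hT hU
    (l := l) (r := r)
  have hTU : ∀ k, φ (Polynomial.aeval (a k) (f k) * Polynomial.aeval (b k) (g k)) =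
      (X k).state (Polynomial.aeval (L k) (f k) (Polynomial.aeval (R k) (g k) (X k).vec)) := by
    intro k
    have h1 := key [k] [k]
    rw [hm (by simp) (by simp)] at h1
    simpa using h1
  rw [key, hm hl hr]
  simp only [hTU]

variable {A : Type u} [NormedRing A] [NormedAlgebra ℂ A]

/-- For bi-free pairs, the moments of alternating products of centred elements of the closed
algebras generated by the variables. -/
theorem IsBiFree.map_prod_mul_prod {φ : A →L[ℂ] ℂ} (hφ : φ 1 = 1) {a b : κ → A}
    (h : IsBiFree.{u, v, w} (φ : A →ₗ[ℂ] ℂ) a b) {α β : κ → A}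
    (hα : ∀ k, α k ∈ (Algebra.adjoin ℂ {a k}).topologicalClosure)
    (hβ : ∀ k, β k ∈ (Algebra.adjoin ℂ {b k}).topologicalClosure)
    (hα0 : ∀ k, φ (α k) = 0) (hβ0 : ∀ k, φ (β k) = 0)
    {l r : List κ} (hl : l.IsChain (· ≠ ·)) (hr : r.IsChain (· ≠ ·)) :
    φ ((l.map α).prod * (r.map β).prod) =
      if l = r then (l.map fun k => φ (α k * β k)).prod else 0 := by
  -- The centring is built into both sides, so that they agree for all polynomials in the variables,
  -- not only centred ones. Density and continuity then suffice.
  let F : (κ → A) × (κ → A) → ℂ := fun p =>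
    φ ((l.map fun k => p.1 k - φ (p.1 k) • 1).prod * (r.map fun k => p.2 k - φ (p.2 k) • 1).prod)
  let G : (κ → A) × (κ → A) → ℂ := fun p =>
    if l = r then
      (l.map fun k => φ ((p.1 k - φ (p.1 k) • 1) * (p.2 k - φ (p.2 k) • 1))).prod else 0
  have hF : Continuous F := by
    refine φ.continuous.comp (.mul ?_ ?_) <;>
      exact continuous_list_prod _ fun k _ => by fun_prop
  have hG : Continuous G := by
    by_cases hlr : l = r
    · simp only [G, hlr, if_true]
      exact continuous_list_prod _ fun k _ => by fun_prop
    · simp only [G, hlr, if_false]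
      exact continuous_const
  let S : Set (κ → A) := Set.pi Set.univ fun k => (Algebra.adjoin ℂ {a k} : Set A)
  let S' : Set (κ → A) := Set.pi Set.univ fun k => (Algebra.adjoin ℂ {b k} : Set A)
  have hFG : Set.EqOn F G (S ×ˢ S') := by
    rintro ⟨x, y⟩ ⟨hx, hy⟩
    have hx' : ∀ k, ∃ f : Polynomial ℂ, Polynomial.aeval (a k) f = x k := fun k => by
      have : x k ∈ Algebra.adjoin ℂ {a k} := hx k (Set.mem_univ k)
      rwa [Algebra.adjoin_singleton_eq_range_aeval] at this
    have hy' : ∀ k, ∃ f : Polynomial ℂ, Polynomial.aeval (b k) f = y k := fun k => by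
      have : y k ∈ Algebra.adjoin ℂ {b k} := hy k (Set.mem_univ k)
      rwa [Algebra.adjoin_singleton_eq_range_aeval] at this
    choose f hf using hx'
    choose g hg using hy'
    have hf' : ∀ k, Polynomial.aeval (a k) (f k - Polynomial.C (φ (x k))) =
        x k - φ (x k) • 1 := fun k => by
      rw [map_sub, hf, Polynomial.aeval_C, Algebra.algebraMap_eq_smul_one]
    have hg' : ∀ k, Polynomial.aeval (b k) (g k - Polynomial.C (φ (y k))) =
        y k - φ (y k) • 1 := fun k => by
      rw [map_sub, hg, Polynomial.aeval_C, Algebra.algebraMap_eq_smul_one]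
    have := h.map_aeval_prod_mul_prod (fun k => f k - Polynomial.C (φ (x k)))
      (fun k => g k - Polynomial.C (φ (y k))) (fun k => by simp only [hf']; simp [hφ])
      (fun k => by simp only [hg']; simp [hφ]) hl hr
    simp only [hf', hg'] at this
    exact this
  have hmem : (α, β) ∈ closure (S ×ˢ S') := by
    rw [closure_prod_eq, closure_pi_set, closure_pi_set]
    exact ⟨fun k _ => hα k, fun k _ => hβ k⟩
  have := hFG.closure hF hG hmem
  simpa [F, G, hα0, hβ0] using this

end Moments

/-! ### Neumann series. -/

section GeometricSeries

theorem ringInverse_eq {R : Type*} [Ring R] {x y : R} (h : x * y = 1) (h' : y * x = 1) :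
    Ring.inverse x = y :=
  Ring.inverse_unit ⟨x, y, h, h'⟩

variable {A : Type u} [NormedRing A] [CompleteSpace A]

theorem hasSum_ringInverse_one_sub {x : A} (hx : ‖x‖ < 1) :
    HasSum (fun n : ℕ => x ^ n) (Ring.inverse (1 - x)) := by
  rw [ringInverse_eq (mul_neg_geom_series x hx) (geom_series_mul_neg x hx)]
  exact (summable_geometric_of_norm_lt_one hx).hasSum

theorem isUnit_one_sub {x : A} (hx : ‖x‖ < 1) : IsUnit (1 - x) :=
  ⟨⟨_, _, mul_neg_geom_series x hx, geom_series_mul_neg x hx⟩, rfl⟩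

end GeometricSeries

/-! ### Weighted sums over all alternating words in two letters. -/

section AlternatingSeries

/-- The list `0, 1, 0, 1, …, 0, 1` of length `2 * n`. -/
def zeroOneList : ℕ → List (Fin 2)
  | 0 => []
  | n + 1 => 0 :: 1 :: zeroOneList n

theorem prod_map_zeroOneList {M : Type*} [Monoid M] (f : Fin 2 → M) (n : ℕ) :
    ((zeroOneList n).map f).prod = (f 0 * f 1) ^ n := by
  induction n with
  | zero => simp [zeroOneList]
  | succ n ih => simp [zeroOneList, ih, pow_succ', mul_assoc]

theorem length_zeroOneList (n : ℕ) : (zeroOneList n).length = 2 * n := by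
  induction n with
  | zero => rfl
  | succ n ih => simp [zeroOneList, ih, mul_add]

theorem zeroOneList_inj {m n : ℕ} : zeroOneList m = zeroOneList n ↔ m = n := by
  refine ⟨fun h => ?_, fun h => h ▸ rfl⟩
  have := congrArg List.length h
  simp only [length_zeroOneList] at this
  omega

theorem isChain_cons_zeroOneList_concat (n : ℕ) :
    (1 :: (zeroOneList n ++ [0])).IsChain (· ≠ ·) := by
  induction n with
  | zero => simp [zeroOneList]
  | succ n ih => simpa [zeroOneList] using ih

theorem isChain_zeroOneList_concat (n : ℕ) : (zeroOneList n ++ [0]).IsChain (· ≠ ·) :=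
  (isChain_cons_zeroOneList_concat n).tail

theorem isChain_cons_zeroOneList (n : ℕ) : (1 :: zeroOneList n).IsChain (· ≠ ·) :=
  List.IsChain.left_of_append (l₂ := [0]) (isChain_cons_zeroOneList_concat n)

theorem isChain_zeroOneList (n : ℕ) : (zeroOneList n).IsChain (· ≠ ·) :=
  (isChain_cons_zeroOneList n).tail

theorem cons_one_ne_zeroOneList (l : List (Fin 2)) (n : ℕ) : 1 :: l ≠ zeroOneList n := by
  cases n <;> simp [zeroOneList]

theorem cons_one_ne_zeroOneList_concat (l : List (Fin 2)) (n : ℕ) :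
    1 :: l ≠ zeroOneList n ++ [0] := by
  cases n <;> simp [zeroOneList]

theorem zeroOneList_ne_concat (m n : ℕ) : zeroOneList m ≠ zeroOneList n ++ [0] := by
  intro h
  have := congrArg List.length h
  simp only [length_zeroOneList, List.length_append, List.length_singleton] at this
  omega

variable {A : Type u} [NormedRing A] [NormedAlgebra ℂ A]

/-- The sum of the `n`-th terms of the series `altSeries`. -/
def altTerm (c d : ℂ) (x : Fin 2 → A) (n : ℕ) : A :=
  (1 + d • x 1) * (c • (x 0 * x 1)) ^ n * (1 + d • x 0)

/-- The sum of all alternating products of `x 0` and `x 1`, weighted by suitable powers of `c`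
and `d`. -/
noncomputable def altSeries (c d : ℂ) (x : Fin 2 → A) : A :=
  (1 + d • x 1) * Ring.inverse (1 - c • (x 0 * x 1)) * (1 + d • x 0)

/-- The words `(01)ⁿ`, `(01)ⁿ0`, `1(01)ⁿ` and `1(01)ⁿ0` exhaust the alternating words, each once, as
`n` varies. -/
theorem altTerm_eq (c d : ℂ) (x : Fin 2 → A) (n : ℕ) :
    altTerm c d x n = c ^ n • (((zeroOneList n).map x).prod +
      d • ((zeroOneList n ++ [0]).map x).prod + d • ((1 :: zeroOneList n).map x).prod +
      d ^ 2 • ((1 :: (zeroOneList n ++ [0])).map x).prod) := by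
  simp only [altTerm, smul_pow, List.map_cons, List.map_append, List.prod_cons, List.prod_append,
    prod_map_zeroOneList, List.map_nil, List.prod_nil, mul_one, add_mul, mul_add, one_mul,
    smul_mul_assoc, mul_smul_comm, mul_assoc]
  module

theorem map_altTerm_mul_altTerm {φ : A →L[ℂ] ℂ} {α β : Fin 2 → A}
    (h : ∀ l r : List (Fin 2), l.IsChain (· ≠ ·) → r.IsChain (· ≠ ·) →
      φ ((l.map α).prod * (r.map β).prod) =
        if l = r then (l.map fun k => φ (α k * β k)).prod else 0) (c d : ℂ) (m n : ℕ) :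
    φ (altTerm 1 1 α m * altTerm c d β n) =
      if m = n then (c * (φ (α 0 * β 0) * φ (α 1 * β 1))) ^ n *
        ((1 + d * φ (α 0 * β 0)) * (1 + d * φ (α 1 * β 1))) else 0 := by
  rw [altTerm_eq, altTerm_eq]
  simp only [one_pow, one_smul, mul_smul_comm, mul_add, add_mul, map_add, map_smul, smul_eq_mul]
  -- Of the sixteen pairs of word types only the four pairs of equal type survive, and these force
  -- `m = n`.
  simp only [h, isChain_zeroOneList, isChain_zeroOneList_concat, isChain_cons_zeroOneList,
    isChain_cons_zeroOneList_concat, cons_one_ne_zeroOneList, (cons_one_ne_zeroOneList _ _).symm,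
    cons_one_ne_zeroOneList_concat, (cons_one_ne_zeroOneList_concat _ _).symm,
    zeroOneList_ne_concat, (zeroOneList_ne_concat _ _).symm, zeroOneList_inj, List.cons.injEq,
    true_and, List.append_left_inj, if_false, add_zero, mul_zero, zero_add]
  simp only [List.map_cons, List.map_append, List.prod_cons, List.prod_append,
    prod_map_zeroOneList, List.map_nil, List.prod_nil, mul_one]
  by_cases hmn : m = n
  · subst hmn
    simp only [if_true]
    rw [mul_pow]
    ring
  · simp [hmn]

variable [CompleteSpace A]

theorem hasSum_altTerm {c d : ℂ} {x : Fin 2 → A} (hx : ‖c • (x 0 * x 1)‖ < 1) :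
    HasSum (altTerm c d x) (altSeries c d x) :=
  ((hasSum_ringInverse_one_sub hx).mul_left _).mul_right _

theorem map_altSeries_mul_altSeries {φ : A →L[ℂ] ℂ} {α β : Fin 2 → A}
    (h : ∀ l r : List (Fin 2), l.IsChain (· ≠ ·) → r.IsChain (· ≠ ·) →
      φ ((l.map α).prod * (r.map β).prod) =
        if l = r then (l.map fun k => φ (α k * β k)).prod else 0) {c d : ℂ}
    (hα : ‖α 0 * α 1‖ < 1) (hβ : ‖c • (β 0 * β 1)‖ < 1)
    (hc : ‖c * (φ (α 0 * β 0) * φ (α 1 * β 1))‖ < 1) :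
    φ (altSeries 1 1 α * altSeries c d β) =
      (1 + d * φ (α 0 * β 0)) * (1 + d * φ (α 1 * β 1)) /
        (1 - c * (φ (α 0 * β 0) * φ (α 1 * β 1))) := by
  have hα' : HasSum (altTerm 1 1 α) (altSeries 1 1 α) := hasSum_altTerm (by simpa using hα)
  -- Summing over the left words with the right index `n` fixed leaves one term, so the double
  -- series is handled as an iterated sum.
  have h1 : ∀ n, φ (altSeries 1 1 α * altTerm c d β n) =
      (c * (φ (α 0 * β 0) * φ (α 1 * β 1))) ^ n *
        ((1 + d * φ (α 0 * β 0)) * (1 + d * φ (α 1 * β 1))) := by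
    intro n
    have h2 := (hα'.mul_right (altTerm c d β n)).mapL φ
    simp only [map_altTerm_mul_altTerm h] at h2
    exact h2.unique (hasSum_ite_eq n _)
  have h3 := ((hasSum_altTerm hβ (d := d)).mul_left (altSeries 1 1 α)).mapL φ
  simp only [h1] at h3
  rw [h3.unique ((hasSum_geometric_of_norm_lt_one hc).mul_right _), div_eq_mul_inv, mul_comm]

end AlternatingSeries

/-! ### Algebraic factorizations behind the two resolvent formulas. -/

section Factorizations

variable {R : Type*} [Ring R]

theorem add_sub_one_mul_of_inverse {e₁ e₂ y₁ y₂ D : R} (h₁ : y₁ * e₁ = 1) (h₂ : y₂ * e₂ = 1)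
    (hD : (1 - (e₁ - 1) * (e₂ - 1)) * D = 1) : (y₁ + y₂ - 1) * (e₂ * D * e₁) = 1 := by
  -- With `y₂ = e₂⁻¹` this says `y₁ + y₂ - 1 = y₁ (1 - (e₁ - 1)(e₂ - 1)) y₂`.
  have h : (y₁ + y₂ - 1) * e₂ = y₁ * (1 - (e₁ - 1) * (e₂ - 1)) := by
    have : y₁ * (1 - (e₁ - 1) * (e₂ - 1)) = y₁ - (y₁ * e₁ - y₁) * (e₂ - 1) := by noncomm_ring
    rw [this, h₁, sub_mul, add_mul, h₂]
    noncomm_ring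
  rw [← mul_assoc, ← mul_assoc, h, mul_assoc y₁, hD, mul_one, h₁]

theorem mul_add_sub_one_of_inverse {e₁ e₂ y₁ y₂ D : R} (h₁ : e₁ * y₁ = 1) (h₂ : e₂ * y₂ = 1)
    (hD : D * (1 - (e₁ - 1) * (e₂ - 1)) = 1) : (e₂ * D * e₁) * (y₁ + y₂ - 1) = 1 := by
  have h : e₁ * (y₁ + y₂ - 1) = (1 - (e₁ - 1) * (e₂ - 1)) * y₂ := by
    have : (1 - (e₁ - 1) * (e₂ - 1)) * y₂ = y₂ - (e₁ - 1) * (e₂ * y₂ - y₂) := by noncomm_ring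
    rw [this, h₂, mul_sub, mul_add, h₁]
    noncomm_ring
  rw [mul_assoc, h, mul_assoc, ← mul_assoc D, hD, one_mul, h₂]

theorem one_sub_smul_mul_mul_of_inverse [Algebra ℂ R] {B₁ B₂ U₁ U₂ D : R} {w : ℂ} (hw : w ≠ 0)
    (hw' : 1 + w ≠ 0) (h₁ : (1 - B₁) * U₁ = 1) (h₂ : (1 - B₂) * U₂ = 1)
    (hD : (1 - (w * (1 + w))⁻¹ • ((U₁ - (1 + w) • 1) * (U₂ - (1 + w) • 1))) * D = 1) :
    (1 - ((1 + w) / w) • (B₁ * B₂)) * ((1 + w) • ((1 + (1 + w)⁻¹ • (U₂ - (1 + w) • 1)) * D *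
      (1 + (1 + w)⁻¹ • (U₁ - (1 + w) • 1)))) = 1 := by
  obtain ⟨p, rfl⟩ : ∃ p, U₁ = (1 + w) • 1 + p := ⟨U₁ - (1 + w) • 1, by abel⟩
  obtain ⟨q, rfl⟩ : ∃ q, U₂ = (1 + w) • 1 + q := ⟨U₂ - (1 + w) • 1, by abel⟩
  simp only [add_sub_cancel_left] at hD ⊢
  -- Up to weights, `v` collects the alternating words that do not begin with `q`, and `x` those
  -- that do not begin with `p`. They solve the system `v = 1 + (1 + w)⁻¹ p x`, `x = 1 + w⁻¹ q v`,
  -- and the claimed inverse is `U₂ v`.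
  obtain ⟨v, hv⟩ : ∃ v, v = D * (1 + (1 + w)⁻¹ • p) := ⟨_, rfl⟩
  obtain ⟨x, hx⟩ : ∃ x, x = 1 + w⁻¹ • (q * v) := ⟨_, rfl⟩
  have hv1 : v = 1 + (1 + w)⁻¹ • (p * x) := by
    have h : v - (w * (1 + w))⁻¹ • (p * (q * v)) = 1 + (1 + w)⁻¹ • p := by
      calc _ = (1 - (w * (1 + w))⁻¹ • (p * q)) * D * (1 + (1 + w)⁻¹ • p) := by
            rw [mul_assoc, ← hv, sub_mul, one_mul, smul_mul_assoc, mul_assoc]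
        _ = _ := by rw [hD, one_mul]
    rw [hx, mul_add, mul_one, mul_smul_comm, smul_add, ← add_assoc, ← h, smul_smul, ← mul_inv,
      mul_comm (1 + w)]
    abel
  have hqv : q * v = w • x - w • 1 := by
    rw [hx, smul_add, smul_smul, mul_inv_cancel₀ hw, one_smul]
    abel
  have hpx : p * x = (1 + w) • v - (1 + w) • 1 := by
    rw [hv1, smul_add, smul_smul, mul_inv_cancel₀ hw', one_smul]
    abel
  have hB₂ : B₂ * (((1 + w) • 1 + q) * v) = w • v + q * v := by
    have : B₂ * ((1 + w) • 1 + q) = w • 1 + q := by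
      have h := h₂
      rw [sub_mul, one_mul, sub_eq_iff_eq_add] at h
      rw [← add_right_inj (1 : R), ← h]
      module
    rw [← mul_assoc, this, add_mul, smul_mul_assoc, one_mul]
  have hB₁ : B₁ * (((1 + w) • 1 + p) * x) = w • x + p * x := by
    have : B₁ * ((1 + w) • 1 + p) = w • 1 + p := by
      have h := h₁
      rw [sub_mul, one_mul, sub_eq_iff_eq_add] at h
      rw [← add_right_inj (1 : R), ← h]
      module
    rw [← mul_assoc, this, add_mul, smul_mul_assoc, one_mul]
  -- Since `B_k U_k = U_k - 1`, the left side is `B₂ U₂ v`. The weights are chosen so that it is a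
  -- multiple of `U₁ x`, on which `B₁` can be evaluated in the same way.
  have hvx : w • v + q * v = (w / (1 + w)) • (((1 + w) • 1 + p) * x) := by
    rw [add_mul, hpx, hqv, smul_mul_assoc, one_mul]
    match_scalars <;> field_simp
  have hU : (1 + w) • ((1 + (1 + w)⁻¹ • q) * D * (1 + (1 + w)⁻¹ • p)) =
      ((1 + w) • 1 + q) * v := by
    rw [mul_assoc, ← hv, ← smul_mul_assoc, smul_add, smul_smul, mul_inv_cancel₀ hw', one_smul]
  rw [hU, sub_mul, one_mul, smul_mul_assoc, mul_assoc, hB₂, hvx, mul_smul_comm, hB₁, smul_smul,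
    show (1 + w) / w * (w / (1 + w)) = 1 by field_simp, one_smul, add_mul, smul_mul_assoc, one_mul,
    hqv, hpx]
  module

end Factorizations

/-! ### Inverse germs: uniqueness, asymptotics and the centred deviations. -/

section LocalInverses

/-- Local injectivity from the inverse function theorem. It makes the inverse germs unique, so that
the ones fixed by choice agree with explicit formulas. -/
theorem eventuallyEq_of_hasStrictDerivAt {ι : Type*} {l : Filter ι} {f : ℂ → ℂ} {f' x : ℂ}
    (hf : HasStrictDerivAt f f' x) (hf' : f' ≠ 0) {p q : ι → ℂ} (hp : Tendsto p l (𝓝 x))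
    (hq : Tendsto q l (𝓝 x)) (h : ∀ᶠ i in l, f (p i) = f (q i)) : p =ᶠ[l] q := by
  have hinj := (hf.hasStrictFDerivAt_equiv hf').eventually_left_inverse
  filter_upwards [hp.eventually hinj, hq.eventually hinj, h] with i h1 h2 h3
  rw [← h1, ← h2, h3]

variable {A : Type u} [NormedRing A] [NormedAlgebra ℂ A]

/-- The deviation of `z⁻¹ (t - a)⁻¹` from the identity. -/
noncomputable def leftDev (a : A) (t z : ℂ) : A := z⁻¹ • Ring.inverse (t • (1 : A) - a) - 1

/-- The deviation of `(1 - sb)⁻¹` from `1 + w`. -/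
noncomputable def rightDev (b : A) (s w : ℂ) : A := Ring.inverse (1 - s • b) - (1 + w) • 1

theorem map_leftDev {φ : A →L[ℂ] ℂ} (hφ : φ 1 = 1) {a : A} {t z : ℂ} (hz : z ≠ 0)
    (h : cauchyG φ a t = z) : φ (leftDev a t z) = 0 := by
  rw [cauchyG] at h
  simp [leftDev, hφ, h, hz]

theorem map_rightDev {φ : A →L[ℂ] ℂ} (hφ : φ 1 = 1) {b : A} {s w : ℂ}
    (h : psi φ b s = w) : φ (rightDev b s w) = 0 := by
  rw [psi, sub_eq_iff_eq_add] at h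
  simp [rightDev, hφ, h, add_comm]

theorem smul_one_sub_eq {t : ℂ} (ht : t ≠ 0) (a : A) :
    t • (1 : A) - a = t • (1 - t⁻¹ • a) := by
  rw [smul_sub, smul_smul, mul_inv_cancel₀ ht, one_smul]

theorem ringInverse_smul {t : ℂ} (ht : t ≠ 0) {x : A} (hx : IsUnit x) :
    Ring.inverse (t • x) = t⁻¹ • Ring.inverse x := by
  refine ringInverse_eq ?_ ?_
  · rw [smul_mul_smul_comm, mul_inv_cancel₀ ht, one_smul, Ring.mul_inverse_cancel x hx]
  · rw [smul_mul_smul_comm, inv_mul_cancel₀ ht, one_smul, Ring.inverse_mul_cancel x hx]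

theorem eventually_norm_smul_lt {ι : Type*} {l : Filter ι} {s : ι → ℂ}
    (hs : Tendsto s l (𝓝 0)) (a : A) : ∀ᶠ i in l, ‖s i • a‖ < 1 := by
  have h : Tendsto (fun i => ‖s i • a‖) l (𝓝 0) := by simpa using (hs.smul_const a).norm
  exact h.eventually_lt_const one_pos

theorem IsInverseG.tendsto_inv {φ : A →L[ℂ] ℂ} {a : A} {K : ℂ → ℂ}
    (h : IsInverseG φ a K) :
    Tendsto (fun z => (K z)⁻¹) (𝓝[≠] 0) (𝓝 0) :=
  tendsto_inv₀_cobounded.comp h.1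

theorem IsInverseG.eventually_ne_zero {φ : A →L[ℂ] ℂ} {a : A} {K : ℂ → ℂ}
    (h : IsInverseG φ a K) : ∀ᶠ z in 𝓝[≠] 0, K z ≠ 0 :=
  h.1.eventually_ne_cobounded 0

theorem IsInversePsi.eventually_ne_zero {φ : A →L[ℂ] ℂ} (hφ : φ 1 = 1) {b : A} {χ : ℂ → ℂ}
    (h : IsInversePsi φ b χ) : ∀ᶠ w in 𝓝[≠] 0, χ w ≠ 0 := by
  filter_upwards [h.2.filter_mono nhdsWithin_le_nhds, self_mem_nhdsWithin] with w hw hw0 hχ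
  rw [hχ] at hw
  exact hw0 (by simp [← hw, psi, hφ])

variable [CompleteSpace A] (φ : A →L[ℂ] ℂ)

/-- The partial sums of the Neumann series are polynomials in `a`. This is what brings resolvents
within reach of the moment formula for closed algebras. -/
theorem ringInverse_one_sub_mem {a : A} {s : ℂ} (h : ‖s • a‖ < 1) :
    Ring.inverse (1 - s • a) ∈ (Algebra.adjoin ℂ {a}).topologicalClosure := by
  refine (Subalgebra.isClosed_topologicalClosure _).mem_of_tendsto
    (hasSum_ringInverse_one_sub h) (Eventually.of_forall fun n => ?_)
  have ha : a ∈ (Algebra.adjoin ℂ {a}).topologicalClosure :=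
    Subalgebra.le_topologicalClosure _ (Algebra.self_mem_adjoin_singleton ℂ a)
  exact sum_mem fun i _ => pow_mem (Subalgebra.smul_mem _ ha s) i

theorem rightDev_mem {b : A} {s : ℂ} (w : ℂ) (h : ‖s • b‖ < 1) :
    rightDev b s w ∈ (Algebra.adjoin ℂ {b}).topologicalClosure :=
  sub_mem (ringInverse_one_sub_mem h) (Subalgebra.smul_mem _ (one_mem _) _)

theorem leftDev_mem {a : A} {t : ℂ} (z : ℂ) (ht : t ≠ 0) (h : ‖t⁻¹ • a‖ < 1) :
    leftDev a t z ∈ (Algebra.adjoin ℂ {a}).topologicalClosure := by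
  rw [leftDev, smul_one_sub_eq ht, ringInverse_smul ht (isUnit_one_sub h)]
  exact sub_mem (Subalgebra.smul_mem _ (Subalgebra.smul_mem _ (ringInverse_one_sub_mem h) _) _)
    (one_mem _)

theorem isUnit_smul_one_sub {a : A} {t : ℂ} (ht : t ≠ 0) (h : ‖t⁻¹ • a‖ < 1) :
    IsUnit (t • (1 : A) - a) := by
  rw [smul_one_sub_eq ht]
  exact (isUnit_one_sub h).smul (Units.mk0 t ht)

theorem cauchyG_eq {a : A} {t : ℂ} (ht : t ≠ 0) (h : ‖t⁻¹ • a‖ < 1) :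
    cauchyG φ a t = t⁻¹ * φ (Ring.inverse (1 - t⁻¹ • a)) := by
  rw [cauchyG, smul_one_sub_eq ht, ringInverse_smul ht (isUnit_one_sub h), map_smul, smul_eq_mul]

theorem tendsto_ringInverse_one_sub {ι : Type*} {l : Filter ι} {s : ι → ℂ}
    (hs : Tendsto s l (𝓝 0)) (a : A) :
    Tendsto (fun i => Ring.inverse (1 - s i • a)) l (𝓝 1) := by
  have h1 : Tendsto (fun i => 1 - s i • a) l (𝓝 1) := by
    simpa using (hs.smul_const a).const_sub 1
  have h2 := NormedRing.inverse_continuousAt (1 : Aˣ)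
  rw [ContinuousAt, Units.val_one, Ring.inverse_one] at h2
  exact h2.comp h1

variable {φ}

section Cauchy

variable {a : A} {K : ℂ → ℂ}

/-- The equation `G_a(K(z)) = z` reads `φ((1 - K(z)⁻¹ a)⁻¹) = z K(z)`, and the left side tends to `φ
1`. -/
theorem IsInverseG.tendsto_mul (hφ : φ 1 = 1) (h : IsInverseG φ a K) :
    Tendsto (fun z => z * K z) (𝓝[≠] 0) (𝓝 1) := by
  have h1 := (φ.continuous.tendsto 1).comp (tendsto_ringInverse_one_sub h.tendsto_inv a)
  rw [hφ] at h1
  refine h1.congr' ?_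
  filter_upwards [h.2, h.eventually_ne_zero, eventually_norm_smul_lt h.tendsto_inv a]
    with z hz hK hn
  rw [cauchyG_eq φ hK hn] at hz
  have h2 : φ (Ring.inverse (1 - (K z)⁻¹ • a)) = K z * z := by
    rw [← eq_inv_mul_iff_mul_eq₀ (inv_ne_zero hK), inv_inv] at hz
    exact hz
  simpa [mul_comm] using h2

theorem IsInverseG.tendsto_leftDev (hφ : φ 1 = 1) (h : IsInverseG φ a K) :
    Tendsto (fun z => leftDev a (K z) z) (𝓝[≠] 0) (𝓝 0) := by
  have h1 := (((h.tendsto_mul hφ).inv₀ one_ne_zero).smul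
    (tendsto_ringInverse_one_sub h.tendsto_inv a)).sub_const 1
  rw [inv_one, one_smul, sub_self] at h1
  refine h1.congr' ?_
  filter_upwards [h.eventually_ne_zero, eventually_norm_smul_lt h.tendsto_inv a] with z hK hn
  rw [leftDev, smul_one_sub_eq hK, ringInverse_smul hK (isUnit_one_sub hn), smul_smul, mul_inv]

theorem IsInverseG.eventuallyEq (hφ : φ 1 = 1) (h : IsInverseG φ a K) {t : ℂ → ℂ}
    (ht : IsInverseG φ a t) : K =ᶠ[𝓝[≠] 0] t := by
  -- This is `G_a` in the coordinate `t⁻¹` at infinity, so uniqueness is proved for the reciprocals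
  -- of the two germs.
  have hg : HasStrictDerivAt (fun t : ℂ => t * φ (Ring.inverse (1 - t • a))) 1 0 := by
    have h1 := (hasStrictDerivAt_id (0 : ℂ)).mul (hasStrictDerivAt_h φ a)
    have h2 : (1 : ℂ) * φ (Ring.inverse (1 - (0 : ℂ) • a)) + id (0 : ℂ) * φ a = 1 := by simp [hφ]
    rw [h2] at h1
    exact h1
  have key := eventuallyEq_of_hasStrictDerivAt hg one_ne_zero h.tendsto_inv ht.tendsto_inv (by
    filter_upwards [h.2, h.eventually_ne_zero, eventually_norm_smul_lt h.tendsto_inv a, ht.2,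
      ht.eventually_ne_zero, eventually_norm_smul_lt ht.tendsto_inv a] with z h1 h2 h3 h4 h5 h6
    rw [← cauchyG_eq φ h2 h3, ← cauchyG_eq φ h5 h6, h1, h4])
  filter_upwards [key] with z hz using inv_injective hz

end Cauchy

section Psi

variable {b : A} {χ : ℂ → ℂ}

theorem IsInversePsi.eventuallyEq (hb : φ b ≠ 0) (h : IsInversePsi φ b χ) {s : ℂ → ℂ}
    (hs : Tendsto s (𝓝[≠] 0) (𝓝 0)) (hs' : ∀ᶠ w in 𝓝[≠] 0, psi φ b (s w) = w) :
    χ =ᶠ[𝓝[≠] 0] s := by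
  have hψ : HasStrictDerivAt (psi φ b) (φ b) 0 := (hasStrictDerivAt_h φ b).sub_const 1
  refine eventuallyEq_of_hasStrictDerivAt hψ hb (h.1.mono_left nhdsWithin_le_nhds) hs ?_
  filter_upwards [h.2.filter_mono nhdsWithin_le_nhds, hs'] with w h1 h2
  rw [h1, h2]

theorem IsInversePsi.tendsto_div (hφ : φ 1 = 1) (hb : φ b ≠ 0) (h : IsInversePsi φ b χ) :
    Tendsto (fun w => χ w / w) (𝓝[≠] 0) (𝓝 (φ b)⁻¹) := by
  have hψ : HasDerivAt (psi φ b) (φ b) 0 := (hasStrictDerivAt_h φ b).hasDerivAt.sub_const 1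
  have hχ : Tendsto χ (𝓝[≠] 0) (𝓝[≠] 0) :=
    tendsto_nhdsWithin_iff.2 ⟨h.1.mono_left nhdsWithin_le_nhds, h.eventually_ne_zero hφ⟩
  refine (((hasDerivAt_iff_tendsto_slope.1 hψ).comp hχ).inv₀ hb).congr' ?_
  filter_upwards [h.2.filter_mono nhdsWithin_le_nhds] with w hw
  have h0 : psi φ b 0 = 0 := by simp [psi, hφ]
  simp [slope_def_field, hw, h0]

/-- From `(1 - χ b)⁻¹ - 1 = χ b (1 - χ b)⁻¹` and `χ(w)/w → (φ b)⁻¹`. The deviation is thus of order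
`w`, which compensates the factor `(w(1 + w))⁻¹` in the series for the product. -/
theorem IsInversePsi.tendsto_rightDev_div (hφ : φ 1 = 1) (hb : φ b ≠ 0)
    (h : IsInversePsi φ b χ) :
    Tendsto (fun w => w⁻¹ • rightDev b (χ w) w) (𝓝[≠] 0) (𝓝 ((φ b)⁻¹ • b - 1)) := by
  have hχ : Tendsto χ (𝓝[≠] 0) (𝓝 0) := h.1.mono_left nhdsWithin_le_nhds
  have h1 := ((h.tendsto_div hφ hb).smul
    ((tendsto_ringInverse_one_sub hχ b).const_mul b)).sub_const 1
  rw [mul_one] at h1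
  refine h1.congr' ?_
  filter_upwards [eventually_norm_smul_lt hχ b, self_mem_nhdsWithin] with w hn hw
  have hw : w ≠ 0 := hw
  have h2 := Ring.mul_inverse_cancel _ (isUnit_one_sub hn)
  rw [sub_mul, one_mul, sub_eq_iff_eq_add, smul_mul_assoc] at h2
  have h3 : rightDev b (χ w) w = χ w • (b * Ring.inverse (1 - χ w • b)) - w • 1 := by
    rw [rightDev, add_smul, one_smul]
    nth_rewrite 1 [h2]
    abel
  rw [h3, smul_sub, smul_smul, smul_smul, inv_mul_cancel₀ hw, one_smul, div_eq_inv_mul]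

theorem IsInversePsi.tendsto_rightDev (h : IsInversePsi φ b χ) :
    Tendsto (fun w => rightDev b (χ w) w) (𝓝[≠] 0) (𝓝 0) := by
  have hχ : Tendsto χ (𝓝[≠] 0) (𝓝 0) := h.1.mono_left nhdsWithin_le_nhds
  have hw : Tendsto (fun w : ℂ => w) (𝓝[≠] 0) (𝓝 0) := nhdsWithin_le_nhds
  simpa [rightDev] using
    (tendsto_ringInverse_one_sub hχ b).sub ((hw.const_add 1).smul_const (1 : A))

end Psi

end LocalInverses

/-! ### Resolvents as alternating series. -/

section Resolvents

variable {A : Type u} [NormedRing A] [NormedAlgebra ℂ A]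

theorem mixedF_eq {φ : A →L[ℂ] ℂ} (hφ : φ 1 = 1) {a b : A} {t s z w : ℂ} (hz : z ≠ 0)
    (ha : φ (leftDev a t z) = 0) (hb : φ (rightDev b s w) = 0) :
    mixedF φ a b t s = z * (1 + w + φ (leftDev a t z * rightDev b s w)) := by
  have h1 : Ring.inverse (t • (1 : A) - a) = z • (1 + leftDev a t z) := by
    rw [leftDev, add_sub_cancel, smul_smul, mul_inv_cancel₀ hz, one_smul]
  have h2 : Ring.inverse (1 - s • b) = (1 + w) • 1 + rightDev b s w := by
    rw [rightDev, add_sub_cancel]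
  rw [mixedF, h1, h2]
  simp only [smul_mul_assoc, add_mul, mul_add, one_mul, mul_smul_comm, mul_one, map_smul, map_add,
    hφ, ha, hb, smul_eq_mul]
  ring

variable [CompleteSpace A]

/-- The resolvent of a sum. -/
theorem ringInverse_smul_one_sub_add {a : Fin 2 → A} {t : Fin 2 → ℂ} {z : ℂ} (hz : z ≠ 0)
    (hu : ∀ k, IsUnit (t k • (1 : A) - a k))
    (hn : ‖leftDev (a 0) (t 0) z * leftDev (a 1) (t 1) z‖ < 1) :
    Ring.inverse ((t 0 + t 1 - z⁻¹) • (1 : A) - (a 0 + a 1)) =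
      z • altSeries 1 1 (fun k => leftDev (a k) (t k) z) := by
  have he : ∀ k, (z • (t k • (1 : A) - a k)) * (1 + leftDev (a k) (t k) z) = 1 := fun k => by
    rw [leftDev, add_sub_cancel, smul_mul_smul_comm, mul_inv_cancel₀ hz, one_smul,
      Ring.mul_inverse_cancel _ (hu k)]
  have he' : ∀ k, (1 + leftDev (a k) (t k) z) * (z • (t k • (1 : A) - a k)) = 1 := fun k => by
    rw [leftDev, add_sub_cancel, smul_mul_smul_comm, inv_mul_cancel₀ hz, one_smul,
      Ring.inverse_mul_cancel _ (hu k)]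
  have hD := isUnit_one_sub hn
  have h1 := add_sub_one_mul_of_inverse (he 0) (he 1)
    (D := Ring.inverse (1 - leftDev (a 0) (t 0) z * leftDev (a 1) (t 1) z))
    (by rw [add_sub_cancel_left, add_sub_cancel_left, Ring.mul_inverse_cancel _ hD])
  have h2 := mul_add_sub_one_of_inverse (he' 0) (he' 1)
    (D := Ring.inverse (1 - leftDev (a 0) (t 0) z * leftDev (a 1) (t 1) z))
    (by rw [add_sub_cancel_left, add_sub_cancel_left, Ring.inverse_mul_cancel _ hD])
  -- The shift by `z⁻¹` produces the `-1` of the factorization of `y₁ + y₂ - 1`, with `y_k = z(t_k -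
  -- a_k)`.
  have h3 : z • ((t 0 + t 1 - z⁻¹) • (1 : A) - (a 0 + a 1)) =
      z • (t 0 • (1 : A) - a 0) + z • (t 1 • (1 : A) - a 1) - 1 := by
    match_scalars <;> field_simp
  rw [← h3] at h1 h2
  refine ringInverse_eq ?_ ?_
  · rw [mul_smul_comm, ← smul_mul_assoc]
    simpa [altSeries] using h1
  · rw [smul_mul_assoc, ← mul_smul_comm]
    simpa [altSeries] using h2

/-- The resolvent of a product. -/
theorem ringInverse_one_sub_smul_mul {b : Fin 2 → A} {s : Fin 2 → ℂ} {w : ℂ} (hw : w ≠ 0)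
    (hw' : 1 + w ≠ 0) (hu : ∀ k, IsUnit (1 - s k • b k))
    (hu' : IsUnit (1 - (s 0 * s 1 * ((1 + w) / w)) • (b 0 * b 1)))
    (hn : ‖(w * (1 + w))⁻¹ • (rightDev (b 0) (s 0) w * rightDev (b 1) (s 1) w)‖ < 1) :
    Ring.inverse (1 - (s 0 * s 1 * ((1 + w) / w)) • (b 0 * b 1)) =
      (1 + w) • altSeries (w * (1 + w))⁻¹ (1 + w)⁻¹ (fun k => rightDev (b k) (s k) w) := by
  have h := one_sub_smul_mul_mul_of_inverse hw hw' (Ring.mul_inverse_cancel _ (hu 0))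
    (Ring.mul_inverse_cancel _ (hu 1)) (Ring.mul_inverse_cancel _ (isUnit_one_sub hn))
  rw [smul_mul_smul_comm, smul_smul, mul_comm ((1 + w) / w)] at h
  -- The algebra supplies only a right inverse; invertibility comes from `hu'`.
  have h' := congrArg (Ring.inverse (1 - (s 0 * s 1 * ((1 + w) / w)) • (b 0 * b 1)) * ·) h
  rw [mul_one, ← mul_assoc, Ring.inverse_mul_cancel _ hu', one_mul] at h'
  exact h'.symm

end Resolvents

/-! ### Inverse germs of the sum and the product, and the mixed transform. -/

section Transforms

variable {A : Type u} [NormedRing A] [NormedAlgebra ℂ A] {φ : A →L[ℂ] ℂ} {a b : Fin 2 → A}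

/-- The pairing of the empty left word with the right word `0, 1` vanishes for the centred `b k`. -/
theorem IsBiFree.map_mul_right (hφ : φ 1 = 1)
    (h : IsBiFree.{u, v, 0} (φ : A →ₗ[ℂ] ℂ) a b) : φ (b 0 * b 1) = φ (b 0) * φ (b 1) := by
  have hb : ∀ k, b k ∈ (Algebra.adjoin ℂ {b k}).topologicalClosure := fun k =>
    Subalgebra.le_topologicalClosure _ (Algebra.self_mem_adjoin_singleton ℂ (b k))
  have h1 := h.map_prod_mul_prod hφ (α := fun _ => 0) (β := fun k => b k - φ (b k) • 1)
    (fun k => zero_mem _) (fun k => sub_mem (hb k) (Subalgebra.smul_mem _ (one_mem _) _))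
    (fun k => map_zero φ) (fun k => by simp [hφ]) (l := []) (r := [0, 1]) (by simp) (by simp)
  simp only [List.map_nil, List.prod_nil, List.map_cons, List.prod_cons, mul_one, one_mul, sub_mul,
    mul_sub, smul_mul_assoc, mul_smul_comm, map_sub, map_smul, hφ, smul_eq_mul] at h1
  simp only [reduceCtorEq, if_false] at h1
  linear_combination h1

variable [CompleteSpace A]

/-- For zero right letters the right series is `1`, so only the empty left word contributes. -/
theorem IsBiFree.map_altSeries_left (hφ : φ 1 = 1)
    (h : IsBiFree.{u, v, 0} (φ : A →ₗ[ℂ] ℂ) a b) {α : Fin 2 → A}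
    (hα : ∀ k, α k ∈ (Algebra.adjoin ℂ {a k}).topologicalClosure) (hα0 : ∀ k, φ (α k) = 0)
    (hn : ‖α 0 * α 1‖ < 1) : φ (altSeries 1 1 α) = 1 := by
  have h1 := map_altSeries_mul_altSeries (φ := φ) (α := α) (β := fun _ => 0)
    (fun l r hl hr => h.map_prod_mul_prod hφ hα (fun k => zero_mem _) hα0 (fun k => map_zero φ)
      hl hr) (c := 0) (d := 0) hn (by simp) (by simp)
  simpa [altSeries] using h1

theorem IsBiFree.map_altSeries_right (hφ : φ 1 = 1)
    (h : IsBiFree.{u, v, 0} (φ : A →ₗ[ℂ] ℂ) a b) {β : Fin 2 → A}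
    (hβ : ∀ k, β k ∈ (Algebra.adjoin ℂ {b k}).topologicalClosure) (hβ0 : ∀ k, φ (β k) = 0)
    {c d : ℂ} (hn : ‖c • (β 0 * β 1)‖ < 1) : φ (altSeries c d β) = 1 := by
  have h1 := map_altSeries_mul_altSeries (φ := φ) (α := fun _ => 0) (β := β)
    (fun l r hl hr => h.map_prod_mul_prod hφ (fun k => zero_mem _) hβ (fun k => map_zero φ) hβ0
      hl hr) (c := c) (d := d) (by simp) hn (by simp)
  simpa [altSeries] using h1

section Left

variable {K : Fin 2 → ℂ → ℂ}

theorem eventually_leftDev (hφ : φ 1 = 1) (hK : ∀ k, IsInverseG φ (a k) (K k)) {ε : ℝ}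
    (hε : 0 < ε) : ∀ᶠ z in 𝓝[≠] 0, z ≠ 0 ∧ ∀ k, IsUnit (K k z • (1 : A) - a k) ∧
      leftDev (a k) (K k z) z ∈ (Algebra.adjoin ℂ {a k}).topologicalClosure ∧
      φ (leftDev (a k) (K k z) z) = 0 ∧ ‖leftDev (a k) (K k z) z‖ < ε := by
  refine eventually_mem_nhdsWithin.and (eventually_all.2 fun k => ?_)
  have h1 : Tendsto (fun z => ‖leftDev (a k) (K k z) z‖) (𝓝[≠] 0) (𝓝 0) := by
    simpa using ((hK k).tendsto_leftDev hφ).norm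
  filter_upwards [(hK k).2, (hK k).eventually_ne_zero,
    eventually_norm_smul_lt (hK k).tendsto_inv (a k), eventually_mem_nhdsWithin,
    h1.eventually_lt_const hε] with z hz hKz hn hz0 hd
  exact ⟨isUnit_smul_one_sub hKz hn, leftDev_mem z hKz hn, map_leftDev hφ hz0 hz, hd⟩

/-- Additivity of the R-transform `K(z) - z⁻¹`: the resolvent at this point is `z` times an
alternating series on which `φ` is `1`. -/
theorem IsBiFree.isInverseG_add (hφ : φ 1 = 1) (h : IsBiFree.{u, v, 0} (φ : A →ₗ[ℂ] ℂ) a b)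
    (hK : ∀ k, IsInverseG φ (a k) (K k)) :
    IsInverseG φ (a 0 + a 1) fun z => K 0 z + K 1 z - z⁻¹ := by
  constructor
  · have h1 : Tendsto (fun z => z * (K 0 z + K 1 z - z⁻¹)) (𝓝[≠] 0) (𝓝 1) := by
      have h2 := (((hK 0).tendsto_mul hφ).add ((hK 1).tendsto_mul hφ)).sub_const 1
      rw [add_sub_cancel_right] at h2
      refine h2.congr' ?_
      filter_upwards [eventually_mem_nhdsWithin] with z hz
      rw [mul_sub, mul_inv_cancel₀ hz, mul_add]
    have h3 : Tendsto (fun z => (K 0 z + K 1 z - z⁻¹)⁻¹) (𝓝[≠] 0) (𝓝[≠] 0) := by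
      refine tendsto_nhdsWithin_iff.2 ⟨?_, ?_⟩
      · have hid : Tendsto (fun z : ℂ => z) (𝓝[≠] 0) (𝓝 0) := nhdsWithin_le_nhds
        have h4 := (h1.inv₀ one_ne_zero).mul hid
        rw [mul_zero] at h4
        refine h4.congr' ?_
        filter_upwards [eventually_mem_nhdsWithin] with z hz
        have hz : z ≠ 0 := hz
        rw [mul_inv, mul_comm, ← mul_assoc, mul_inv_cancel₀ hz, one_mul]
      · filter_upwards [h1.eventually_ne one_ne_zero] with z hz
        exact inv_ne_zero (right_ne_zero_of_mul hz)
    simpa [Function.comp_def] using tendsto_inv₀_nhdsNE_zero.comp h3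
  · filter_upwards [eventually_leftDev hφ hK one_pos] with z ⟨hz, hd⟩
    have hn : ‖leftDev (a 0) (K 0 z) z * leftDev (a 1) (K 1 z) z‖ < 1 :=
      (norm_mul_le _ _).trans_lt
        (mul_lt_one_of_nonneg_of_lt_one_left (norm_nonneg _) (hd 0).2.2.2 (hd 1).2.2.2.le)
    rw [cauchyG, ringInverse_smul_one_sub_add (t := fun k => K k z) hz (fun k => (hd k).1) hn,
      map_smul, h.map_altSeries_left hφ (fun k => (hd k).2.1) (fun k => (hd k).2.2.1) hn,
      smul_eq_mul, mul_one]

end Left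

section Right

variable {χ : Fin 2 → ℂ → ℂ}

/-- The norm bounds involve `w` alone. They will also control the mixed moments, so that `z` and `w`
can be taken small independently. -/
theorem eventually_rightDev (hφ : φ 1 = 1) (hb : ∀ k, φ (b k) ≠ 0)
    (hχ : ∀ k, IsInversePsi φ (b k) (χ k)) :
    ∀ᶠ w in 𝓝[≠] 0, w ≠ 0 ∧ 1 + w ≠ 0 ∧
      ‖(w * (1 + w))⁻¹‖ * (‖rightDev (b 0) (χ 0 w) w‖ * ‖rightDev (b 1) (χ 1 w) w‖) < 1 ∧
      ∀ k, IsUnit (1 - χ k w • b k) ∧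
        rightDev (b k) (χ k w) w ∈ (Algebra.adjoin ℂ {b k}).topologicalClosure ∧
        φ (rightDev (b k) (χ k w) w) = 0 ∧ ‖(1 + w)⁻¹‖ * ‖rightDev (b k) (χ k w) w‖ < 1 := by
  have hw : Tendsto (fun w : ℂ => 1 + w) (𝓝[≠] 0) (𝓝 1) := by
    have : Tendsto (fun w : ℂ => w) (𝓝[≠] 0) (𝓝 0) := nhdsWithin_le_nhds
    simpa using this.const_add 1
  have hw' : Tendsto (fun w : ℂ => ‖(1 + w)⁻¹‖) (𝓝[≠] 0) (𝓝 1) := by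
    simpa using (hw.inv₀ one_ne_zero).norm
  refine eventually_mem_nhdsWithin.and ((hw.eventually_ne one_ne_zero).and (.and ?_
    (eventually_all.2 fun k => ?_)))
  -- One deviation absorbs the factor `w⁻¹` and stays bounded; the other tends to `0`.
  · have h1 := hw'.mul ((((hχ 0).tendsto_rightDev_div hφ (hb 0)).norm).mul
      (((hχ 1).tendsto_rightDev).norm))
    rw [norm_zero, mul_zero, mul_zero] at h1
    filter_upwards [h1.eventually_lt_const one_pos] with w h2
    rw [norm_smul] at h2
    rw [mul_inv, norm_mul]
    linarith
  · have h0 : Tendsto (χ k) (𝓝[≠] 0) (𝓝 0) := (hχ k).1.mono_left nhdsWithin_le_nhds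
    have h1 := hw'.mul ((hχ k).tendsto_rightDev.norm)
    rw [norm_zero, mul_zero] at h1
    filter_upwards [(hχ k).2.filter_mono nhdsWithin_le_nhds, eventually_norm_smul_lt h0 (b k),
      h1.eventually_lt_const one_pos] with w hw hn hd
    exact ⟨isUnit_one_sub hn, rightDev_mem w hn, map_rightDev hφ hw, hd⟩

theorem tendsto_inversePsi_mul (hφ : φ 1 = 1) (hb : ∀ k, φ (b k) ≠ 0)
    (hχ : ∀ k, IsInversePsi φ (b k) (χ k)) :
    Tendsto (fun w => χ 0 w * χ 1 w * ((1 + w) / w)) (𝓝[≠] 0) (𝓝 0) := by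
  have hid : Tendsto (fun w : ℂ => w) (𝓝[≠] 0) (𝓝 0) := nhdsWithin_le_nhds
  have h0 : Tendsto (χ 1) (𝓝[≠] 0) (𝓝 0) := (hχ 1).1.mono_left nhdsWithin_le_nhds
  have h1 := (((hχ 0).tendsto_div hφ (hb 0)).mul h0).mul (hid.const_add 1)
  rw [mul_zero, zero_mul] at h1
  exact h1.congr fun w => by ring

/-- Multiplicativity of the S-transform `𝒳(w)(1 + w)/w`: the resolvent is `1 + w` times an
alternating series on which `φ` is `1`. -/
theorem IsBiFree.eventually_psi_mul (hφ : φ 1 = 1) (h : IsBiFree.{u, v, 0} (φ : A →ₗ[ℂ] ℂ) a b)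
    (hb : ∀ k, φ (b k) ≠ 0) (hχ : ∀ k, IsInversePsi φ (b k) (χ k)) :
    ∀ᶠ w in 𝓝[≠] 0, psi φ (b 0 * b 1) (χ 0 w * χ 1 w * ((1 + w) / w)) = w := by
  filter_upwards [eventually_rightDev hφ hb hχ,
    eventually_norm_smul_lt (tendsto_inversePsi_mul hφ hb hχ) (b 0 * b 1)]
    with w ⟨hw, hw', hn, hd⟩ hs
  have hn' : ‖(w * (1 + w))⁻¹ • (rightDev (b 0) (χ 0 w) w * rightDev (b 1) (χ 1 w) w)‖ < 1 := by
    rw [norm_smul]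
    exact (mul_le_mul_of_nonneg_left (norm_mul_le _ _) (norm_nonneg _)).trans_lt hn
  rw [psi, ringInverse_one_sub_smul_mul (s := fun k => χ k w) hw hw' (fun k => (hd k).1)
    (isUnit_one_sub hs) hn', map_smul,
    h.map_altSeries_right hφ (fun k => (hd k).2.1) (fun k => (hd k).2.2.1) hn', smul_eq_mul,
    mul_one, add_sub_cancel_left]

end Right

/-- The relation between the values of `mixedF` that expresses the multiplicativity of the
`T`-transform. -/
theorem tTransform_identity {z w P Q f₁ f₂ f : ℂ} (hz : z ≠ 0) (hw : w ≠ 0) (hw' : 1 + w ≠ 0)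
    (hP : 1 + (1 + w)⁻¹ * P ≠ 0) (hQ : 1 + (1 + w)⁻¹ * Q ≠ 0)
    (hPQ : 1 - (w * (1 + w))⁻¹ * (P * Q) ≠ 0) (h₁ : f₁ = z * (1 + w + P))
    (h₂ : f₂ = z * (1 + w + Q))
    (hf : f = z * ((1 + w) * ((1 + (1 + w)⁻¹ * P) * (1 + (1 + w)⁻¹ * Q) /
      (1 - (w * (1 + w))⁻¹ * (P * Q))))) :
    (w + 1) / w * (1 - z / f) =
      (w + 1) / w * (1 - z / f₁) * ((w + 1) / w * (1 - z / f₂)) := by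
  have hP' : 1 + w + P ≠ 0 := by
    have : 1 + w + P = (1 + w) * (1 + (1 + w)⁻¹ * P) := by field_simp
    rw [this]
    exact mul_ne_zero hw' hP
  have hQ' : 1 + w + Q ≠ 0 := by
    have : 1 + w + Q = (1 + w) * (1 + (1 + w)⁻¹ * Q) := by field_simp
    rw [this]
    exact mul_ne_zero hw' hQ
  have hPQ' : w * (1 + w) - P * Q ≠ 0 := by
    have : w * (1 + w) - P * Q = w * (1 + w) * (1 - (w * (1 + w))⁻¹ * (P * Q)) := by field_simp
    rw [this]
    exact mul_ne_zero (mul_ne_zero hw hw') hPQ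
  have hf' : f = z * (w * ((1 + w + P) * (1 + w + Q)) / (w * (1 + w) - P * Q)) := by
    rw [hf]
    field_simp
  -- Here `1 - z/f₁ = (w + P)/(1 + w + P)`, likewise for `f₂` with `Q`, and the numerator of `1 -
  -- z/f` factors as `(1 + w)(w + P)(w + Q)`.
  rw [hf', h₁, h₂]
  field_simp
  ring

theorem IsBiFree.mixedF_add_mul (hφ : φ 1 = 1) (h : IsBiFree.{u, v, 0} (φ : A →ₗ[ℂ] ℂ) a b)
    {t s : Fin 2 → ℂ} {z w : ℂ} (hz : z ≠ 0) (hw : w ≠ 0) (hw' : 1 + w ≠ 0)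
    (ha : ∀ k, IsUnit (t k • (1 : A) - a k))
    (hα : ∀ k, leftDev (a k) (t k) z ∈ (Algebra.adjoin ℂ {a k}).topologicalClosure)
    (hα0 : ∀ k, φ (leftDev (a k) (t k) z) = 0)
    (hb : ∀ k, IsUnit (1 - s k • b k))
    (hb' : IsUnit (1 - (s 0 * s 1 * ((1 + w) / w)) • (b 0 * b 1)))
    (hβ : ∀ k, rightDev (b k) (s k) w ∈ (Algebra.adjoin ℂ {b k}).topologicalClosure)
    (hβ0 : ∀ k, φ (rightDev (b k) (s k) w) = 0)
    (hn : ‖leftDev (a 0) (t 0) z * leftDev (a 1) (t 1) z‖ < 1)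
    (hn' : ‖(w * (1 + w))⁻¹ • (rightDev (b 0) (s 0) w * rightDev (b 1) (s 1) w)‖ < 1)
    (hc : ‖(w * (1 + w))⁻¹ * (φ (leftDev (a 0) (t 0) z * rightDev (b 0) (s 0) w) *
      φ (leftDev (a 1) (t 1) z * rightDev (b 1) (s 1) w))‖ < 1) :
    mixedF φ (a 0 + a 1) (b 0 * b 1) (t 0 + t 1 - z⁻¹) (s 0 * s 1 * ((1 + w) / w)) =
      z * ((1 + w) * ((1 + (1 + w)⁻¹ * φ (leftDev (a 0) (t 0) z * rightDev (b 0) (s 0) w)) *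
        (1 + (1 + w)⁻¹ * φ (leftDev (a 1) (t 1) z * rightDev (b 1) (s 1) w)) /
        (1 - (w * (1 + w))⁻¹ * (φ (leftDev (a 0) (t 0) z * rightDev (b 0) (s 0) w) *
          φ (leftDev (a 1) (t 1) z * rightDev (b 1) (s 1) w))))) := by
  rw [mixedF, ringInverse_smul_one_sub_add hz ha hn, ringInverse_one_sub_smul_mul hw hw' hb hb' hn',
    smul_mul_smul_comm, map_smul, smul_eq_mul, mul_assoc]
  exact congrArg _ (congrArg _ (map_altSeries_mul_altSeries
    (fun l r hl hr => h.map_prod_mul_prod hφ hα hβ hα0 hβ0 hl hr) hn hn' hc))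

theorem IsBiFree.eventually_mixedF (hφ : φ 1 = 1) (h : IsBiFree.{u, v, 0} (φ : A →ₗ[ℂ] ℂ) a b)
    (hb : ∀ k, φ (b k) ≠ 0) {K χ : Fin 2 → ℂ → ℂ} {K' χ' : ℂ → ℂ}
    (hK : ∀ k, IsInverseG φ (a k) (K k)) (hχ : ∀ k, IsInversePsi φ (b k) (χ k))
    (hb' : φ (b 0 * b 1) ≠ 0) (hK' : IsInverseG φ (a 0 + a 1) K')
    (hχ' : IsInversePsi φ (b 0 * b 1) χ') :
    ∀ᶠ p : ℂ × ℂ in 𝓝[≠] 0 ×ˢ 𝓝[≠] 0,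
      (p.2 + 1) / p.2 * (1 - p.1 / mixedF φ (a 0 + a 1) (b 0 * b 1) (K' p.1) (χ' p.2)) =
        (p.2 + 1) / p.2 * (1 - p.1 / mixedF φ (a 0) (b 0) (K 0 p.1) (χ 0 p.2)) *
          ((p.2 + 1) / p.2 * (1 - p.1 / mixedF φ (a 1) (b 1) (K 1 p.1) (χ 1 p.2))) := by
  have hK' := hK'.eventuallyEq hφ (h.isInverseG_add hφ hK)
  have hχ' := hχ'.eventuallyEq hb' (tendsto_inversePsi_mul hφ hb hχ)
    (h.eventually_psi_mul hφ hb hχ)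
  have hs := eventually_norm_smul_lt (tendsto_inversePsi_mul hφ hb hχ) (b 0 * b 1)
  -- With left deviations below this bound, each mixed moment is at most the norm of its right
  -- deviation, uniformly in `z`. The added `1` also keeps the bound at most `1`, as the left series
  -- requires.
  have hε : 0 < (‖φ‖ + 1)⁻¹ := inv_pos.2 (by positivity)
  have hε1 : (‖φ‖ + 1)⁻¹ ≤ 1 := inv_le_one_of_one_le₀ (by simp)
  have hφε : ‖φ‖ * (‖φ‖ + 1)⁻¹ ≤ 1 := by
    rw [← div_eq_mul_inv, div_le_one (by positivity)]
    simp
  filter_upwards [((eventually_leftDev hφ hK hε).and hK').prod_mk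
    (((eventually_rightDev hφ hb hχ).and hχ').and hs)]
  rintro ⟨z, w⟩ ⟨⟨⟨hz, hα⟩, hKz⟩, ⟨⟨hw, hw', hc, hβ⟩, hχw⟩, hs⟩
  have hP : ∀ k, ‖φ (leftDev (a k) (K k z) z *
      rightDev (b k) (χ k w) w)‖ ≤
      ‖rightDev (b k) (χ k w) w‖ := fun k => by
    refine (φ.le_opNorm _).trans ?_
    calc _ ≤ ‖φ‖ * ((‖φ‖ + 1)⁻¹ * ‖rightDev (b k) (χ k w) w‖) := by
          gcongr
          exact (norm_mul_le _ _).trans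
            (mul_le_mul_of_nonneg_right (hα k).2.2.2.le (norm_nonneg _))
      _ ≤ _ := by
          rw [← mul_assoc]
          exact mul_le_of_le_one_left (norm_nonneg _) hφε
  have hne : ∀ x : ℂ, ‖x‖ < 1 → 1 + x ≠ 0 := fun x hx h0 => by
    rw [eq_neg_of_add_eq_zero_right h0, norm_neg, norm_one] at hx
    exact hx.false
  have hP1 : ∀ k, 1 + (1 + w)⁻¹ * φ (leftDev (a k) (K k z) z *
      rightDev (b k) (χ k w) w) ≠ 0 := fun k => by
    refine hne _ ?_
    rw [norm_mul]
    exact (mul_le_mul_of_nonneg_left (hP k) (norm_nonneg _)).trans_lt (hβ k).2.2.2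
  have hPQ : ‖(w * (1 + w))⁻¹ * (φ (leftDev (a 0) (K 0 z) z *
      rightDev (b 0) (χ 0 w) w) * φ (leftDev (a 1) (K 1 z) z *
      rightDev (b 1) (χ 1 w) w))‖ < 1 := by
    rw [norm_mul, norm_mul]
    refine lt_of_le_of_lt ?_ hc
    gcongr
    exacts [hP 0, hP 1]
  have hn : ‖leftDev (a 0) (K 0 z) z * leftDev (a 1) (K 1 z) z‖ < 1 :=
    (norm_mul_le _ _).trans_lt (mul_lt_one_of_nonneg_of_lt_one_left (norm_nonneg _)
      ((hα 0).2.2.2.trans_le hε1) ((hα 1).2.2.2.le.trans hε1))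
  have hn' : ‖(w * (1 + w))⁻¹ • (rightDev (b 0) (χ 0 w) w *
      rightDev (b 1) (χ 1 w) w)‖ < 1 := by
    rw [norm_smul]
    exact (mul_le_mul_of_nonneg_left (norm_mul_le _ _) (norm_nonneg _)).trans_lt hc
  refine tTransform_identity hz hw hw' (hP1 0) (hP1 1) ?_
    (mixedF_eq hφ hz (hα 0).2.2.1 (hβ 0).2.2.1) (mixedF_eq hφ hz (hα 1).2.2.1 (hβ 1).2.2.1) ?_
  · rw [sub_eq_add_neg]
    exact hne _ (by rwa [norm_neg])
  · dsimp only
    rw [hKz, hχw]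
    exact h.mixedF_add_mul hφ (t := fun k => K k z)
      (s := fun k => χ k w) hz hw hw' (fun k => (hα k).1)
      (fun k => (hα k).2.1) (fun k => (hα k).2.2.1) (fun k => (hβ k).1) (isUnit_one_sub hs)
      (fun k => (hβ k).2.1) (fun k => (hβ k).2.2.1) hn hn' hPQ

theorem isInverseG_invG (hφ : φ 1 = 1) (x : A) : IsInverseG φ x (invG φ hφ x) :=
  (exists_isInverseG φ hφ x).choose_spec

theorem isInversePsi_invPsi (hφ : φ 1 = 1) (x : A) (hx : φ x ≠ 0) :
    IsInversePsi φ x (invPsi φ hφ x hx) :=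
  (exists_isInversePsi φ hφ x hx).choose_spec

theorem IsBiFree.tTransform_add_mul (hφ : φ 1 = 1) (h : IsBiFree.{u, v, 0} (φ : A →ₗ[ℂ] ℂ) a b)
    (hb : ∀ k, φ (b k) ≠ 0) (hb' : φ (b 0 * b 1) ≠ 0) :
    ∀ᶠ p : ℂ × ℂ in 𝓝[≠] 0 ×ˢ 𝓝[≠] 0,
      tTransform φ hφ (a 0 + a 1) (b 0 * b 1) hb' p.1 p.2 =
        tTransform φ hφ (a 0) (b 0) (hb 0) p.1 p.2 *
          tTransform φ hφ (a 1) (b 1) (hb 1) p.1 p.2 := by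
  exact h.eventually_mixedF hφ hb (K := fun k => invG φ hφ (a k))
    (χ := fun k => invPsi φ hφ (b k) (hb k)) (fun k => isInverseG_invG hφ (a k))
    (fun k => isInversePsi_invPsi hφ (b k) (hb k)) hb' (isInverseG_invG hφ _)
    (isInversePsi_invPsi hφ _ hb')

end Transforms

end BiFree

theorem theorem3p1 {A : Type u} [NormedRing A] [NormedAlgebra ℂ A] [CompleteSpace A]
    (φ : A →L[ℂ] ℂ) (hφ : φ 1 = 1) (a₁ b₁ a₂ b₂ : A)
    (hfree : BiFree.IsBiFree.{u, v, 0} (φ : A →ₗ[ℂ] ℂ) ![a₁, a₂] ![b₁, b₂])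
    (hb₁ : φ b₁ ≠ 0) (hb₂ : φ b₂ ≠ 0) :
    ∃ hb : φ (b₁ * b₂) ≠ 0, ∀ᶠ p : ℂ × ℂ in 𝓝 (0, 0), p.1 ≠ 0 → p.2 ≠ 0 →
      BiFree.tTransform φ hφ (a₁ + a₂) (b₁ * b₂) hb p.1 p.2 =
        BiFree.tTransform φ hφ a₁ b₁ hb₁ p.1 p.2 * BiFree.tTransform φ hφ a₂ b₂ hb₂ p.1 p.2 := by
  have hb : φ (b₁ * b₂) ≠ 0 := by
    have h : φ (b₁ * b₂) = φ b₁ * φ b₂ := hfree.map_mul_right hφ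
    rw [h]
    exact mul_ne_zero hb₁ hb₂
  refine ⟨hb, ?_⟩
  have h := hfree.tTransform_add_mul hφ (Fin.forall_fin_two.2 ⟨hb₁, hb₂⟩) hb
  rw [← nhdsWithin_prod_eq, eventually_nhdsWithin_iff] at h
  -- The product of the punctured filters is the neighbourhood filter within the set where both
  -- coordinates are nonzero.
  filter_upwards [h] with p hp h1 h2 using hp ⟨h1, h2⟩
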